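/- **Setting.** Let $\mathcal H$ be a real reproducing kernel Hilbert space of functions on $\mathcal X$ with kernel $K$, and let $P_X$ be a probability measure on $\mathcal X$. Suppose that $K(a,b)=\sum_{k\ge1}\mu_k\phi_k(a)\phi_k(b)$ for all $a,b\in\mathcal X$, where $\mu_1\ge\mu_2\ge\cdots>0$ and the measurable functions $\phi_k\in\mathcal H$ satisfy $\langle\phi_k,\phi_l\rangle_{L^2(P_X)}=\delta_{kl}$ and $\langle\phi_k,\phi_l\rangle_{\mathcal H}=\delta_{kl}/\mu_k$. Suppose also that $\sup_k\sup_{a\in\mathcal X}|\phi_k(a)|<\infty$ and $\sup_{k\ge1}\frac{\sum_{i>k}\mu_i}{k\mu_k}<\infty$. For $\lambda>0$ let $s_\lambda$ be the number of $\mu_k$ greater than $\lambda$. For each $n$ let $\lambda=\lambda_n>0$ and $s=s_n\in\mathbb N$, and observe $y_i=f(x_i)+\epsilon_i$, $1\le i\le n$, where $f\in\mathcal H$, $\boldsymbol x=(x_1,\dots,x_n)$ is i.i.d. from $P_X$, and $\epsilon_1,\dots,\epsilon_n$ are i.i.d. $N(0,1)$. Let $S$ be a random $s\times n$ real matrix,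 possibly depending on $\boldsymbol x$, such that $\epsilon=(\epsilon_1,\dots,\epsilon_n)$ is independent of $(\boldsymbol x,S)$. Put $\boldsymbol K=[n^{-1}K(x_i,x_j)]_{1\le i,j\le n}$, let $\widehat\beta\in\mathbb R^s$ be a minimizer of $$\beta^\top (S\boldsymbol K)(\boldsymbol KS^\top)\beta-\tfrac2n\beta^\top S\boldsymbol K\boldsymbol y+\lambda\,\beta^\top S\boldsymbol KS^\top\beta ,$$ and put $\widehat f_R=\sum_{i=1}^n(S^\top\widehat\beta)_iK(\cdot,x_i)$ and $T_{n,\lambda}=\|\widehat f_R\|_n^2=\frac1n\sum_{i=1}^n\widehat f_R(x_i)^2$. **Assumption on $S$.** Let $U_1$ (resp. $U_2$) be the matrix whose columns are the orthonormal eigenvectors of $\boldsymbol K$ with eigenvalue $>\lambda$ (resp. $\le\lambda$), and let $D_2$ be the diagonal matrix of the eigenvalues $\le\lambda$. There are constants $c\in(0,\infty)$ and $c_1,c_2\in(0,\infty]$, independent of $n$, such that for all large $n$ the event $$\mathcal E_n=\Big\{\|(SU_1)^\top SU_1-I\|_{\rm op}\le\tfrac12,\ \ \|SU_2D_2^{1/2}\|_{\rm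 op}\le c\lambda^{1/2}\Big\}$$ satisfies $P\big(P(\mathcal E_n\mid\boldsymbol x)\ge1-e^{-c_1s}\big)\ge1-e^{-c_2s_\lambda}$. **Theorem 4.2.** Suppose that $\lambda\to0$ and $s\to\infty$ as $n\to\infty$. Let $\Delta=\boldsymbol KS^\top(S\boldsymbol K^2S^\top+\lambda S\boldsymbol KS^\top)^{-1}S\boldsymbol K$, where $(\cdot)^{-1}$ is read as the Moore–Penrose inverse if the matrix is singular. Then under $H_0:f=0$, for every $n$, $T_{n,\lambda}$ is square integrable and, almost surely, $$\mu_{n,\lambda}:=E\{T_{n,\lambda}\mid\boldsymbol x,S\}=\frac{\operatorname{tr}(\Delta^2)}n,\qquad \sigma_{n,\lambda}^2:=\operatorname{Var}\{T_{n,\lambda}\mid\boldsymbol x,S\}=\frac{2\operatorname{tr}(\Delta^4)}{n^2},$$ and $$\frac{T_{n,\lambda}-\mu_{n,\lambda}}{\sigma_{n,\lambda}}\xrightarrow{d}N(0,1)\qquad(n\to\infty),$$ where the quotient is set to $0$ when $\sigma_{n,\lambda}=0$. -/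

import Mathlib

open MeasureTheory ProbabilityTheory Filter Topology
open scoped Matrix ENNReal InnerProductSpace

noncomputable section

namespace SketchedKRR

section Kernel

variable {𝒳 : Type*} (H : Type*) [NormedAddCommGroup H] [InnerProductSpace ℝ H]
  [CompleteSpace H] [RKHS ℝ H 𝒳 ℝ]

/-- The scalar reproducing kernel `K(a, b)` of a real reproducing kernel Hilbert space `H` of
functions on `𝒳`. -/
def kern (a b : 𝒳) : ℝ := RKHS.kernel H a b 1

/-- The empirical kernel matrix `[n⁻¹ K(x_i, x_j)]`. -/
def kernelMatrix {n : ℕ} (x : Fin n → 𝒳) : Matrix (Fin n) (Fin n) ℝ :=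
  Matrix.of fun i j => (n : ℝ)⁻¹ * kern H (x i) (x j)

theorem kern_symm (a b : 𝒳) : kern H a b = kern H b a := by
  have h1 := RKHS.kernel_inner H a b (1 : ℝ) (1 : ℝ)
  have h2 := RKHS.kernel_inner H b a (1 : ℝ) (1 : ℝ)
  have h3 := h1.trans ((real_inner_comm _ _).trans h2.symm)
  simpa [kern] using h3

theorem kernelMatrix_isHermitian {n : ℕ} (x : Fin n → 𝒳) : (kernelMatrix H x).IsHermitian := by
  ext i j
  simp [kernelMatrix, kern_symm H (x i) (x j)]

/-- A spectral (Mercer) expansion `K(a, b) = ∑ μ_k φ_k(a) φ_k(b)` of the kernel of `H` with respect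
to the design distribution `PX`: the eigenvalues `μ_0 ≥ μ_1 ≥ ⋯ > 0` are ordered and positive, and
the eigenfunctions are orthonormal in `L²(PX)` and orthogonal in `H` with `‖φ_k‖² = 1 / μ_k`.
(Indices start at `0`.) -/
structure IsMercerExpansion [MeasurableSpace 𝒳] (PX : Measure 𝒳) (μ : ℕ → ℝ) (φ : ℕ → H) :
    Prop where
  antitone : Antitone μ
  pos : ∀ k, 0 < μ k
  measurable : ∀ k, Measurable (fun a : 𝒳 => φ k a)
  orthonormal_L2 : ∀ k l, ∫ a, φ k a * φ l a ∂PX = if k = l then 1 else 0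
  inner_H : ∀ k l, ⟪φ k, φ l⟫_ℝ = if k = l then (μ k)⁻¹ else 0
  expansion : ∀ a b : 𝒳, HasSum (fun k => μ k * φ k a * φ k b) (kern H a b)

/-- Uniformly bounded eigenfunctions, and the tail sum condition
`sup_{k ≥ 1} (∑_{i > k} μ_i) / (k μ_k) < ∞`, here with eigenvalues indexed from `0`: the `k`-th
eigenvalue is `μ (k - 1)` and the tail after it is `∑_i μ (k + i)`. -/
structure EigenRegular (μ : ℕ → ℝ) (φ : ℕ → H) : Prop where
  bounded : ∃ C : ℝ, ∀ k, ∀ a : 𝒳, |φ k a| ≤ C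
  summable : Summable μ
  tail : ∃ C : ℝ, ∀ k : ℕ, 1 ≤ k → ∑' i, μ (k + i) ≤ C * (k * μ (k - 1))

end Kernel

/-- `s_λ`, the number of eigenvalues greater than `λ`: for a nonincreasing sequence indexed from
`0` this is the first index whose eigenvalue is at most `λ`. -/
def effDim (μ : ℕ → ℝ) (lam : ℝ) : ℕ := sInf {k | μ k ≤ lam}

/-- Euclidean operator norm of a rectangular real matrix. -/
def opNorm {ι κ : Type*} [Fintype ι] [Fintype κ] [DecidableEq κ] (A : Matrix ι κ ℝ) : ℝ :=
  ‖(Matrix.toEuclideanLin A).toContinuousLinearMap‖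

section Satisfiable

variable {n s : ℕ} {K : Matrix (Fin n) (Fin n) ℝ}

/-- The orthonormal eigenvectors (as columns) of `K` whose eigenvalue is greater than `λ`. -/
def topEigvecs (hK : K.IsHermitian) (lam : ℝ) :
    Matrix (Fin n) {i : Fin n // lam < hK.eigenvalues i} ℝ :=
  (hK.eigenvectorUnitary : Matrix (Fin n) (Fin n) ℝ).submatrix id Subtype.val

/-- The remaining orthonormal eigenvectors of `K`, those whose eigenvalue is at most `λ`. -/
def botEigvecs (hK : K.IsHermitian) (lam : ℝ) :
    Matrix (Fin n) {i : Fin n // hK.eigenvalues i ≤ lam} ℝ :=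
  (hK.eigenvectorUnitary : Matrix (Fin n) (Fin n) ℝ).submatrix id Subtype.val

/-- `D₂^{1/2}`, the square roots of the eigenvalues of `K` that are at most `λ`. -/
def botSqrt (hK : K.IsHermitian) (lam : ℝ) :
    Matrix {i : Fin n // hK.eigenvalues i ≤ lam} {i : Fin n // hK.eigenvalues i ≤ lam} ℝ :=
  Matrix.diagonal fun i => √(hK.eigenvalues i.1)

/-- `S` is `K`-satisfiable with constant `c`:
`‖(S U₁)ᵀ S U₁ - I‖ ≤ 1/2` and `‖S U₂ D₂^{1/2}‖ ≤ c λ^{1/2}` in operator norm. -/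
def KSatisfiable (hK : K.IsHermitian) (lam c : ℝ) (S : Matrix (Fin s) (Fin n) ℝ) : Prop :=
  opNorm ((S * topEigvecs hK lam)ᵀ * (S * topEigvecs hK lam) - 1) ≤ 1 / 2 ∧
    opNorm (S * botEigvecs hK lam * botSqrt hK lam) ≤ c * √lam

end Satisfiable

/-- The event `E` is of `(a, b)`-type given the random element `x`:
`P(P(E | x) ≥ 1 - exp(-a)) ≥ 1 - exp(-b)`, with `exp(-∞) = 0`. -/
def IsOfType {Ω β : Type*} [MeasurableSpace Ω] [mβ : MeasurableSpace β] (P : Measure Ω)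
    (x : Ω → β) (E : Set Ω) (a b : ℝ≥0∞) : Prop :=
  1 - EReal.exp (-(b : EReal)) ≤
    P {ω | 1 - EReal.exp (-(a : EReal)) ≤ ENNReal.ofReal ((P⟦E | mβ.comap x⟧) ω)}

section Estimator

variable {n s : ℕ}

/-- The matrix `S K² Sᵀ + λ S K Sᵀ`. -/
def normalMatrix (K : Matrix (Fin n) (Fin n) ℝ) (S : Matrix (Fin s) (Fin n) ℝ) (lam : ℝ) :
    Matrix (Fin s) (Fin s) ℝ :=
  S * K ^ 2 * Sᵀ + lam • (S * K * Sᵀ)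

/-- The Moore–Penrose inverse of a real symmetric matrix: in the spectral decomposition, nonzero
eigenvalues are inverted and zero eigenvalues are kept. It is the inverse of an invertible
symmetric matrix. -/
def symPinv {ι : Type*} [Fintype ι] [DecidableEq ι] (A : Matrix ι ι ℝ) : Matrix ι ι ℝ :=
  cfc (fun t : ℝ => t⁻¹) A

theorem symPinv_eq_inv {ι : Type*} [Fintype ι] [DecidableEq ι] {A : Matrix ι ι ℝ}
    (hA : A.IsHermitian) (hdet : IsUnit A.det) : symPinv A = A⁻¹ := by
  obtain ⟨u, rfl⟩ := (Matrix.isUnit_iff_isUnit_det A).2 hdet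
  rw [symPinv, cfc_inv_id (R := ℝ) u hA.isSelfAdjoint, Matrix.coe_units_inv]

/-- `Δ = K Sᵀ (S K² Sᵀ + λ S K Sᵀ)⁻¹ S K`. -/
def hatMatrix (K : Matrix (Fin n) (Fin n) ℝ) (S : Matrix (Fin s) (Fin n) ℝ) (lam : ℝ) :
    Matrix (Fin n) (Fin n) ℝ :=
  K * Sᵀ * symPinv (normalMatrix K S lam) * S * K

/-- The sketched ridge criterion
`βᵀ (S K)(K Sᵀ) β - (2/n) βᵀ S K y + λ βᵀ S K Sᵀ β`. -/
def criterion (K : Matrix (Fin n) (Fin n) ℝ) (S : Matrix (Fin s) (Fin n) ℝ) (lam : ℝ)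
    (y : Fin n → ℝ) (β : Fin s → ℝ) : ℝ :=
  β ⬝ᵥ (((S * K) * (K * Sᵀ)) *ᵥ β) - 2 / n * (β ⬝ᵥ ((S * K) *ᵥ y))
    + lam * (β ⬝ᵥ ((S * K * Sᵀ) *ᵥ β))

variable {𝒳 : Type*} {H : Type*} [NormedAddCommGroup H] [InnerProductSpace ℝ H]
  [CompleteSpace H] [RKHS ℝ H 𝒳 ℝ]

/-- The responses `y_i = f(x_i) + ε_i`. -/
def response (f : H) (x : Fin n → 𝒳) (ε : Fin n → ℝ) : Fin n → ℝ := fun i => f (x i) + ε i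

/-- `g` is a sketched kernel ridge regression estimate `f̂_R = ∑ (Sᵀ β̂)_i K(·, x_i)`, where `β̂`
minimizes the sketched ridge criterion. -/
def IsSketchedKRR (x : Fin n → 𝒳) (y : Fin n → ℝ) (S : Matrix (Fin s) (Fin n) ℝ) (lam : ℝ)
    (g : H) : Prop :=
  ∃ β : Fin s → ℝ, (∀ β' : Fin s → ℝ,
      criterion (kernelMatrix H x) S lam y β ≤ criterion (kernelMatrix H x) S lam y β') ∧
    ∀ a : 𝒳, g a = ∑ i, (Sᵀ *ᵥ β) i * kern H a (x i)

/-- The squared empirical norm `‖g‖_n² = n⁻¹ ∑ g(x_i)²`. -/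
def empNormSq (x : Fin n → 𝒳) (g : H) : ℝ := (n : ℝ)⁻¹ * ∑ i, g (x i) ^ 2

/-- `tr(Δ²) / n`. -/
def nullMean (Δ : Matrix (Fin n) (Fin n) ℝ) : ℝ := (Δ ^ 2).trace / n

/-- `2 tr(Δ⁴) / n²`. -/
def nullVar (Δ : Matrix (Fin n) (Fin n) ℝ) : ℝ := 2 * (Δ ^ 4).trace / (n : ℝ) ^ 2

end Estimator

end SketchedKRR

end

/-! Under the null hypothesis the data are pure noise, and the normal equations turn the statistic
into `n⁻¹‖Δε‖²`, with `Δ` symmetric and independent of `ε`. Given `(x, S)`, rotating `ε` into the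
eigenbasis of `Δ` gives a weighted sum of independent `χ²₁` variables with weights `dⱼ²/n`; the
conditional mean and variance are read off from it. After standardization the weights are `bⱼ =
dⱼ²/√tr(Δ⁴)`, with `∑ bⱼ² = 1`. Since `Δ` is a contraction, `max bⱼ ≤ 1/√tr(Δ⁴)`, so the central
limit theorem only needs `tr(Δ⁴) → ∞` in probability (`exists_norm_charFun_quadStat_sub_le`).

The trace is bounded below in two moves. On the satisfiability event, a vector built from the sketch
shows that `⟨u, Δu⟩` exceeds a constant at every eigenvector `u` of the kernel matrix with
eigenvalue above `λ` (`quadForm_hatMatrix_eigvec_ge`), so `tr(Δ⁴)` dominates the number of such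
eigenvalues. For each fixed `M` that number is at least `M` with probability tending to one: the
first `M` eigenfunctions are nearly orthonormal on the sample by the weak law, and `λ` drops below
`μ (M - 1) / 2` (`IsMercerExpansion.le_card_eigenvalues`). As `M` stays fixed, no rate linking `λ`
to `n` enters.

Finally the conditional characteristic function is integrated over `(x, S)`; the event of small
trace costs at most twice its probability (`norm_charFun_standardized_sub_le`). -/

namespace SketchedKRR

/-! ### Moore–Penrose inverse by functional calculus -/

section Pinv

variable {ι : Type*} [Fintype ι] [DecidableEq ι] {A : Matrix ι ι ℝ}

/-- The spectrum is finite, so the functional calculus accepts `t ↦ t⁻¹` although it jumps at `0`.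
-/
theorem continuousOn_real_spectrum (A : Matrix ι ι ℝ) (f : ℝ → ℝ) :
    ContinuousOn f (spectrum ℝ A) :=
  (Matrix.finite_real_spectrum (A := A)).continuousOn f

/-- On the spectrum this is `t * t⁻¹ * t = t`, true at `0` as well because `0⁻¹ = 0`. -/
theorem mul_symPinv_mul (hA : A.IsHermitian) : A * symPinv A * A = A := by
  have hA' : IsSelfAdjoint A := hA
  have hc := continuousOn_real_spectrum A
  rw [symPinv]
  nth_rewrite 1 [← cfc_id ℝ A hA']
  nth_rewrite 3 [← cfc_id ℝ A hA']
  rw [← cfc_mul _ _ A (hc _) (hc _), ← cfc_mul _ _ A (hc _) (hc _)]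
  nth_rewrite 2 [← cfc_id ℝ A hA']
  congr 1
  funext t
  by_cases ht : t = 0 <;> simp [ht]

theorem symPinv_transpose (A : Matrix ι ι ℝ) : (symPinv A)ᵀ = symPinv A := by
  have h : IsSelfAdjoint (symPinv A) := cfc_predicate _ _
  rw [← Matrix.conjTranspose_eq_transpose_of_trivial]
  exact h

end Pinv

/-! ### Algebra of the hat matrix and the normal equations -/

section Hat

variable {n s : ℕ} {K : Matrix (Fin n) (Fin n) ℝ} {S : Matrix (Fin s) (Fin n) ℝ} {lam : ℝ}

theorem transpose_eq_of_posSemidef (hK : K.PosSemidef) : Kᵀ = K := by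
  rw [← Matrix.conjTranspose_eq_transpose_of_trivial]
  exact hK.1

theorem normalMatrix_transpose (hK : K.PosSemidef) :
    (normalMatrix K S lam)ᵀ = normalMatrix K S lam := by
  simp [normalMatrix, Matrix.transpose_mul, transpose_eq_of_posSemidef hK, Matrix.mul_assoc]

theorem normalMatrix_isHermitian (hK : K.PosSemidef) : (normalMatrix K S lam).IsHermitian := by
  rw [Matrix.IsHermitian, Matrix.conjTranspose_eq_transpose_of_trivial]
  exact normalMatrix_transpose hK

theorem dotProduct_mulVec_eq_transpose {ι κ : Type*} [Fintype ι] [Fintype κ] (M : Matrix ι κ ℝ)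
    (v : ι → ℝ) (w : κ → ℝ) : v ⬝ᵥ (M *ᵥ w) = (Mᵀ *ᵥ v) ⬝ᵥ w := by
  rw [Matrix.dotProduct_mulVec, Matrix.mulVec_transpose]

theorem normalMatrix_quadForm (hK : K.PosSemidef) (β : Fin s → ℝ) :
    β ⬝ᵥ (normalMatrix K S lam *ᵥ β) = (K *ᵥ (Sᵀ *ᵥ β)) ⬝ᵥ (K *ᵥ (Sᵀ *ᵥ β))
      + lam * ((Sᵀ *ᵥ β) ⬝ᵥ (K *ᵥ (Sᵀ *ᵥ β))) := by
  have h := transpose_eq_of_posSemidef hK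
  rw [normalMatrix, Matrix.add_mulVec, dotProduct_add, Matrix.smul_mulVec, dotProduct_smul,
    smul_eq_mul]
  simp only [← Matrix.mulVec_mulVec, pow_two, dotProduct_mulVec_eq_transpose S,
    dotProduct_mulVec_eq_transpose K, h]

theorem quadForm_nonneg (hK : K.PosSemidef) (v : Fin n → ℝ) : 0 ≤ v ⬝ᵥ (K *ᵥ v) := by
  simpa using hK.dotProduct_mulVec_nonneg v

theorem dotProduct_self_nonneg' {ι : Type*} [Fintype ι] (v : ι → ℝ) : 0 ≤ v ⬝ᵥ v :=
  Finset.sum_nonneg fun i _ => mul_self_nonneg (v i)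

theorem normalMatrix_quadForm_nonneg (hK : K.PosSemidef) (hlam : 0 ≤ lam) (β : Fin s → ℝ) :
    0 ≤ β ⬝ᵥ (normalMatrix K S lam *ᵥ β) := by
  rw [normalMatrix_quadForm hK]
  exact add_nonneg (dotProduct_self_nonneg' _) (mul_nonneg hlam (quadForm_nonneg hK _))

/-- The kernel of the normal matrix is annihilated by `K Sᵀ`. -/
theorem mulVec_eq_zero_of_normalMatrix (hK : K.PosSemidef) (hlam : 0 ≤ lam) {β : Fin s → ℝ}
    (h : normalMatrix K S lam *ᵥ β = 0) : K *ᵥ (Sᵀ *ᵥ β) = 0 := by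
  have h1 := normalMatrix_quadForm (S := S) (lam := lam) hK β
  rw [h, dotProduct_zero] at h1
  have h2 := dotProduct_self_nonneg' (K *ᵥ (Sᵀ *ᵥ β))
  have h3 := mul_nonneg hlam (quadForm_nonneg hK (Sᵀ *ᵥ β))
  exact dotProduct_self_eq_zero.1 (by linarith)

theorem hatMatrix_transpose (hK : K.PosSemidef) :
    (hatMatrix K S lam)ᵀ = hatMatrix K S lam := by
  simp [hatMatrix, Matrix.transpose_mul, transpose_eq_of_posSemidef hK, symPinv_transpose,
    Matrix.mul_assoc]

theorem hatMatrix_isHermitian (hK : K.PosSemidef) : (hatMatrix K S lam).IsHermitian := by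
  rw [Matrix.IsHermitian, Matrix.conjTranspose_eq_transpose_of_trivial]
  exact hatMatrix_transpose hK

/-- The coefficients whose fitted values are `Δ w`. -/
theorem hatMatrix_mulVec (w : Fin n → ℝ) :
    hatMatrix K S lam *ᵥ w
      = K *ᵥ (Sᵀ *ᵥ (symPinv (normalMatrix K S lam) *ᵥ (S *ᵥ (K *ᵥ w)))) := by
  simp only [hatMatrix, ← Matrix.mulVec_mulVec]

/-- With `A` the normal matrix, `v - A⁺Av` lies in the kernel of `A`, which `K Sᵀ` annihilates.
Transposing this says that `S K w` lies in the range of `A`, so `A⁺ S K w` solves the normal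
equations even when `A` is singular. -/
theorem normalMatrix_mul_symPinv_mulVec (hK : K.PosSemidef) (hlam : 0 ≤ lam) (w : Fin n → ℝ) :
    normalMatrix K S lam *ᵥ (symPinv (normalMatrix K S lam) *ᵥ (S *ᵥ (K *ᵥ w)))
      = S *ᵥ (K *ᵥ w) := by
  set A := normalMatrix K S lam with hA
  have hsymm : Aᵀ = A := normalMatrix_transpose hK
  have key : ∀ v : Fin s → ℝ, K *ᵥ (Sᵀ *ᵥ (v - symPinv A *ᵥ (A *ᵥ v))) = 0 := by
    intro v
    apply mulVec_eq_zero_of_normalMatrix hK hlam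
    rw [← hA, Matrix.mulVec_sub]
    simp only [Matrix.mulVec_mulVec]
    rw [← Matrix.mul_assoc, mul_symPinv_mul (normalMatrix_isHermitian hK), sub_self]
  refine dotProduct_eq _ _ fun v => ?_
  have h1 := congrArg (fun u => w ⬝ᵥ u) (key v)
  simp only [Matrix.mulVec_sub, dotProduct_sub, dotProduct_zero, sub_eq_zero] at h1
  simp only [dotProduct_mulVec_eq_transpose, Matrix.transpose_transpose, hsymm, symPinv_transpose,
    transpose_eq_of_posSemidef hK] at h1
  exact h1.symm

theorem dotProduct_fitted (hK : K.PosSemidef) (w : Fin n → ℝ) (β : Fin s → ℝ) :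
    w ⬝ᵥ (K *ᵥ (Sᵀ *ᵥ β)) = β ⬝ᵥ (S *ᵥ (K *ᵥ w)) := by
  rw [dotProduct_mulVec_eq_transpose S, dotProduct_mulVec_eq_transpose K w,
    transpose_eq_of_posSemidef hK, dotProduct_comm]

/-- `‖Δ w‖² ≤ ⟨w, Δ w⟩`. -/
theorem hatMatrix_contraction (hK : K.PosSemidef) (hlam : 0 ≤ lam) (w : Fin n → ℝ) :
    (hatMatrix K S lam *ᵥ w) ⬝ᵥ (hatMatrix K S lam *ᵥ w) ≤ w ⬝ᵥ (hatMatrix K S lam *ᵥ w) := by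
  set β := symPinv (normalMatrix K S lam) *ᵥ (S *ᵥ (K *ᵥ w)) with hβ
  have h1 := normalMatrix_mul_symPinv_mulVec (S := S) hK hlam w
  have h2 := normalMatrix_quadForm (S := S) (lam := lam) hK β
  have h3 := mul_nonneg hlam (quadForm_nonneg hK (Sᵀ *ᵥ β))
  have h4 : hatMatrix K S lam *ᵥ w = K *ᵥ (Sᵀ *ᵥ β) := hatMatrix_mulVec w
  rw [← hβ] at h1
  -- Now `h2` splits `⟨w, Δw⟩` into `‖Δw‖²` and a nonnegative penalty.
  rw [h1] at h2
  have h5 := dotProduct_fitted (S := S) hK w β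
  rw [h4, h5, h2]
  linarith

/-- Variational lower bound for the quadratic form of `Δ`. -/
theorem hatMatrix_quadForm_ge (hK : K.PosSemidef) (hlam : 0 ≤ lam) (w : Fin n → ℝ)
    (β : Fin s → ℝ) :
    2 * (w ⬝ᵥ (K *ᵥ (Sᵀ *ᵥ β))) - β ⬝ᵥ (normalMatrix K S lam *ᵥ β)
      ≤ w ⬝ᵥ (hatMatrix K S lam *ᵥ w) := by
  set b := symPinv (normalMatrix K S lam) *ᵥ (S *ᵥ (K *ᵥ w)) with hb
  have h1 := normalMatrix_mul_symPinv_mulVec (S := S) hK hlam w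
  rw [← hb] at h1
  have h4 : hatMatrix K S lam *ᵥ w = K *ᵥ (Sᵀ *ᵥ b) := hatMatrix_mulVec w
  have h5 := dotProduct_fitted (S := S) hK w
  -- Completing the square: `⟨w, Δw⟩` is the maximum over `β` of the left-hand side, attained at
  -- `b`.
  have h6 := normalMatrix_quadForm_nonneg (S := S) hK hlam (β - b)
  have h7 : b ⬝ᵥ (normalMatrix K S lam *ᵥ β) = β ⬝ᵥ (normalMatrix K S lam *ᵥ b) := by
    rw [dotProduct_mulVec_eq_transpose, normalMatrix_transpose hK, dotProduct_comm]
  rw [Matrix.mulVec_sub, sub_dotProduct, dotProduct_sub, dotProduct_sub, h7, h1] at h6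
  rw [h4, h5, h5]
  linarith

/-- Normal equations: a minimizer of the sketched criterion has fitted values `Δ y`. -/
theorem fitted_eq_of_isMinimizer (hK : K.PosSemidef) (hlam : 0 ≤ lam) (y : Fin n → ℝ)
    {β : Fin s → ℝ} (hβ : ∀ β', criterion K S lam y β ≤ criterion K S lam y β') :
    (n : ℝ) • (K *ᵥ (Sᵀ *ᵥ β)) = hatMatrix K S lam *ᵥ y := by
  rcases Nat.eq_zero_or_pos n with rfl | hn
  · exact Subsingleton.elim _ _
  have hcrit : ∀ β, criterion K S lam y β = β ⬝ᵥ (normalMatrix K S lam *ᵥ β)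
      - 2 / n * (β ⬝ᵥ (S *ᵥ (K *ᵥ y))) := by
    intro β
    simp only [criterion, normalMatrix, Matrix.add_mulVec, dotProduct_add, Matrix.smul_mulVec,
      dotProduct_smul, smul_eq_mul, Matrix.mulVec_mulVec, pow_two, Matrix.mul_assoc]
    ring
  have hnormal : normalMatrix K S lam *ᵥ β = (n : ℝ)⁻¹ • (S *ᵥ (K *ᵥ y)) := by
    set g := normalMatrix K S lam *ᵥ β - (n : ℝ)⁻¹ • (S *ᵥ (K *ᵥ y)) with hg
    -- Here `g` is half the gradient of the criterion at `β`; minimality is tested along `β + t •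
    -- g`.
    have hmin : ∀ t : ℝ, 0 ≤ 2 * t * (g ⬝ᵥ g) + t ^ 2 * (g ⬝ᵥ (normalMatrix K S lam *ᵥ g)) := by
      intro t
      have h := hβ (β + t • g)
      have h7 : β ⬝ᵥ (normalMatrix K S lam *ᵥ g) = g ⬝ᵥ (normalMatrix K S lam *ᵥ β) := by
        rw [dotProduct_mulVec_eq_transpose, normalMatrix_transpose hK, dotProduct_comm]
      have h8 : g ⬝ᵥ g = g ⬝ᵥ (normalMatrix K S lam *ᵥ β)
          - (n : ℝ)⁻¹ * (g ⬝ᵥ (S *ᵥ (K *ᵥ y))) := by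
        conv_lhs => rw [hg, dotProduct_sub, ← hg, dotProduct_smul, smul_eq_mul]
      rw [hcrit, hcrit] at h
      simp only [Matrix.mulVec_add, Matrix.mulVec_smul, add_dotProduct, dotProduct_add,
        smul_dotProduct, dotProduct_smul, smul_eq_mul, h7] at h
      rw [h8]
      have : (2 : ℝ) / n = 2 * (n : ℝ)⁻¹ := by ring
      rw [this] at h
      nlinarith
    have hzero : g ⬝ᵥ g = 0 := by
      by_contra hne
      have hpos : 0 < g ⬝ᵥ g := lt_of_le_of_ne (dotProduct_self_nonneg' g) (Ne.symm hne)
      set q := g ⬝ᵥ (normalMatrix K S lam *ᵥ g)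
      have hq : 0 ≤ q := normalMatrix_quadForm_nonneg hK hlam g
      -- A descent step; the `+ 1` keeps the denominator positive when the curvature `q` is zero.
      have h := hmin (-(g ⬝ᵥ g) / (q + 1))
      have hq1 : 0 < q + 1 := by linarith
      have e : 2 * (-(g ⬝ᵥ g) / (q + 1)) * (g ⬝ᵥ g) + (-(g ⬝ᵥ g) / (q + 1)) ^ 2 * q
          = -((g ⬝ᵥ g) ^ 2 * (q + 2) / (q + 1) ^ 2) := by
        field_simp
        ring
      rw [e] at h
      have : 0 < (g ⬝ᵥ g) ^ 2 * (q + 2) / (q + 1) ^ 2 := by positivity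
      linarith
    exact sub_eq_zero.1 (dotProduct_self_eq_zero.1 hzero)
  set b := symPinv (normalMatrix K S lam) *ᵥ (S *ᵥ (K *ᵥ y)) with hb
  have h1 := normalMatrix_mul_symPinv_mulVec (S := S) hK hlam y
  rw [← hb] at h1
  have hn0 : (n : ℝ) ≠ 0 := by positivity
  -- Both `n • β` and `b` solve the same linear system, so they differ by a kernel vector: the
  -- fitted values are unique although `β` need not be.
  have h2 : K *ᵥ (Sᵀ *ᵥ (n • β - b)) = 0 := by
    apply mulVec_eq_zero_of_normalMatrix (lam := lam) hK hlam
    rw [Matrix.mulVec_sub, h1, ← Nat.cast_smul_eq_nsmul ℝ, Matrix.mulVec_smul, hnormal,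
      smul_smul, mul_inv_cancel₀ hn0, one_smul, sub_self]
  rw [hatMatrix_mulVec, ← hb, ← sub_eq_zero]
  rw [Matrix.mulVec_sub, Matrix.mulVec_sub, ← Nat.cast_smul_eq_nsmul ℝ, Matrix.mulVec_smul,
    Matrix.mulVec_smul] at h2
  exact h2

end Hat

/-! ### Operator norm bounds in terms of dot products -/

section Norm

variable {ι κ : Type*} [Fintype ι] [Fintype κ]

theorem norm_toLp_sq (v : ι → ℝ) : ‖WithLp.toLp 2 v‖ ^ 2 = v ⬝ᵥ v := by
  rw [EuclideanSpace.real_norm_sq_eq]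
  simp [dotProduct, pow_two]

theorem dotProduct_sq_le (v w : ι → ℝ) : (v ⬝ᵥ w) ^ 2 ≤ (v ⬝ᵥ v) * (w ⬝ᵥ w) := by
  simpa [dotProduct, pow_two] using Finset.sum_mul_sq_le_sq_mul_sq Finset.univ v w

theorem mulVec_dotProduct_self_le [DecidableEq κ] (A : Matrix ι κ ℝ) {c : ℝ} (hA : opNorm A ≤ c)
    (v : κ → ℝ) : (A *ᵥ v) ⬝ᵥ (A *ᵥ v) ≤ c ^ 2 * (v ⬝ᵥ v) := by
  have h := (Matrix.toEuclideanLin A).toContinuousLinearMap.le_opNorm (WithLp.toLp 2 v)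
  have h2 : ‖(Matrix.toEuclideanLin A).toContinuousLinearMap (WithLp.toLp 2 v)‖ ^ 2
      = (A *ᵥ v) ⬝ᵥ (A *ᵥ v) := by
    rw [← norm_toLp_sq]
    rfl
  rw [← h2, ← norm_toLp_sq, ← mul_pow]
  refine pow_le_pow_left₀ (norm_nonneg _) (h.trans ?_) 2
  exact mul_le_mul_of_nonneg_right hA (norm_nonneg _)

/-- Cauchy–Schwarz gives `‖Aᵀv‖² = ⟨v, AAᵀv⟩ ≤ c ‖v‖ ‖Aᵀv‖`, and one factor cancels. -/
theorem transpose_mulVec_dotProduct_self_le [DecidableEq κ] (A : Matrix ι κ ℝ) {c : ℝ}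
    (hA : opNorm A ≤ c) (v : ι → ℝ) : (Aᵀ *ᵥ v) ⬝ᵥ (Aᵀ *ᵥ v) ≤ c ^ 2 * (v ⬝ᵥ v) := by
  set q := (Aᵀ *ᵥ v) ⬝ᵥ (Aᵀ *ᵥ v) with hq
  have h1 : q = v ⬝ᵥ (A *ᵥ (Aᵀ *ᵥ v)) := by rw [dotProduct_mulVec_eq_transpose]
  have h2 := dotProduct_sq_le v (A *ᵥ (Aᵀ *ᵥ v))
  have h3 := mulVec_dotProduct_self_le A hA (Aᵀ *ᵥ v)
  rw [← h1] at h2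
  rw [← hq] at h3
  have hv := dotProduct_self_nonneg' v
  have hq0 : 0 ≤ q := dotProduct_self_nonneg' _
  rcases hq0.eq_or_lt with h0 | h0
  · rw [← h0]; positivity
  · have h4 : q * q ≤ (c ^ 2 * (v ⬝ᵥ v)) * q := by nlinarith [mul_le_mul_of_nonneg_left h3 hv]
    exact le_of_mul_le_mul_right h4 h0

/-- A matrix within `1/2` of the identity has a nonexpanding inverse up to a factor `2`. -/
theorem exists_mulVec_eq_of_opNorm_sub_one_le [DecidableEq κ] (G : Matrix κ κ ℝ)
    (hG : opNorm (G - 1) ≤ 1 / 2) (e : κ → ℝ) : ∃ g, G *ᵥ g = e ∧ g ⬝ᵥ e ≤ 2 * (e ⬝ᵥ e) := by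
  -- Coercivity of the quadratic form of `G`: it makes `G` injective, hence surjective in finite
  -- dimension.
  have hlow : ∀ g, g ⬝ᵥ g ≤ 2 * (g ⬝ᵥ (G *ᵥ g)) := by
    intro g
    have h1 := mulVec_dotProduct_self_le (G - 1) hG g
    have h2 := dotProduct_sq_le g ((G - 1) *ᵥ g)
    have h3 := dotProduct_self_nonneg' g
    have h4 : |g ⬝ᵥ ((G - 1) *ᵥ g)| ≤ 1 / 2 * (g ⬝ᵥ g) := by
      refine abs_le_of_sq_le_sq ?_ (by positivity)
      nlinarith [mul_le_mul_of_nonneg_left h1 h3]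
    rw [Matrix.sub_mulVec, Matrix.one_mulVec, dotProduct_sub] at h4
    linarith [(abs_le.1 h4).1]
  have hinj : Function.Injective (Matrix.mulVecLin G) := by
    refine (injective_iff_map_eq_zero _).2 fun g hg => ?_
    rw [Matrix.mulVecLin_apply] at hg
    have h := hlow g
    rw [hg, dotProduct_zero, mul_zero] at h
    exact dotProduct_self_eq_zero.1 (le_antisymm h (dotProduct_self_nonneg' g))
  obtain ⟨g, hg⟩ := LinearMap.injective_iff_surjective.1 hinj e
  rw [Matrix.mulVecLin_apply] at hg
  refine ⟨g, hg, ?_⟩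
  have h := hlow g
  rw [hg] at h
  have h2 := dotProduct_sq_le g e
  have h3 := dotProduct_self_nonneg' g
  have h4 := dotProduct_self_nonneg' e
  nlinarith

end Norm

/-! ### Eigenbasis coordinates and the lower bound on the trace -/

section Spectral

variable {n s : ℕ} {K : Matrix (Fin n) (Fin n) ℝ}

/-- The orthogonal matrix of eigenvectors. -/
noncomputable abbrev eigvecs (hK : K.IsHermitian) : Matrix (Fin n) (Fin n) ℝ :=
  (hK.eigenvectorUnitary : Matrix (Fin n) (Fin n) ℝ)

theorem eigvecs_mul_transpose (hK : K.IsHermitian) : eigvecs hK * (eigvecs hK)ᵀ = 1 := by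
  have h := Unitary.coe_mul_star_self hK.eigenvectorUnitary
  rwa [Unitary.coe_star, Matrix.star_eq_conjTranspose, Matrix.conjTranspose_eq_transpose_of_trivial] at h

theorem eigvecs_transpose_mul (hK : K.IsHermitian) : (eigvecs hK)ᵀ * eigvecs hK = 1 := by
  have h := Unitary.coe_star_mul_self hK.eigenvectorUnitary
  rwa [Matrix.star_eq_conjTranspose, Matrix.conjTranspose_eq_transpose_of_trivial] at h

theorem eq_eigvecs_mul_diagonal (hK : K.IsHermitian) :
    K = eigvecs hK * Matrix.diagonal hK.eigenvalues * (eigvecs hK)ᵀ := by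
  have h := hK.spectral_theorem
  rw [Unitary.conjStarAlgAut_apply, Matrix.star_eq_conjTranspose,
    Matrix.conjTranspose_eq_transpose_of_trivial] at h
  exact h

theorem dotProduct_eq_eigvecs (hK : K.IsHermitian) (v w : Fin n → ℝ) :
    v ⬝ᵥ w = ((eigvecs hK)ᵀ *ᵥ v) ⬝ᵥ ((eigvecs hK)ᵀ *ᵥ w) := by
  rw [dotProduct_mulVec_eq_transpose, Matrix.transpose_transpose, Matrix.mulVec_mulVec,
    eigvecs_mul_transpose, Matrix.one_mulVec]

theorem eigvecs_transpose_mulVec_mulVec (hK : K.IsHermitian) (v : Fin n → ℝ) (j : Fin n) :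
    ((eigvecs hK)ᵀ *ᵥ (K *ᵥ v)) j = hK.eigenvalues j * ((eigvecs hK)ᵀ *ᵥ v) j := by
  have h : (eigvecs hK)ᵀ * K = Matrix.diagonal hK.eigenvalues * (eigvecs hK)ᵀ := by
    calc (eigvecs hK)ᵀ * K
        = (eigvecs hK)ᵀ * (eigvecs hK * Matrix.diagonal hK.eigenvalues * (eigvecs hK)ᵀ) := by
          rw [← eq_eigvecs_mul_diagonal hK]
      _ = _ := by
          rw [← Matrix.mul_assoc, ← Matrix.mul_assoc, eigvecs_transpose_mul, Matrix.one_mul]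
  rw [Matrix.mulVec_mulVec, h, ← Matrix.mulVec_mulVec, Matrix.mulVec_diagonal]

theorem mulVec_dotProduct_self_eq_sum (hK : K.IsHermitian) (v : Fin n → ℝ) :
    (K *ᵥ v) ⬝ᵥ (K *ᵥ v) = ∑ j, hK.eigenvalues j ^ 2 * ((eigvecs hK)ᵀ *ᵥ v) j ^ 2 := by
  rw [dotProduct_eq_eigvecs hK]
  refine Finset.sum_congr rfl fun j _ => ?_
  rw [eigvecs_transpose_mulVec_mulVec]
  ring

theorem quadForm_eq_sum (hK : K.IsHermitian) (v : Fin n → ℝ) :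
    v ⬝ᵥ (K *ᵥ v) = ∑ j, hK.eigenvalues j * ((eigvecs hK)ᵀ *ᵥ v) j ^ 2 := by
  rw [dotProduct_eq_eigvecs hK]
  refine Finset.sum_congr rfl fun j _ => ?_
  rw [eigvecs_transpose_mulVec_mulVec]
  ring

/-- The `i`-th eigenvector. -/
noncomputable def eigvec (hK : K.IsHermitian) (i : Fin n) : Fin n → ℝ := eigvecs hK *ᵥ Pi.single i 1

theorem eigvecs_transpose_mulVec_eigvec (hK : K.IsHermitian) (i : Fin n) :
    (eigvecs hK)ᵀ *ᵥ eigvec hK i = Pi.single i 1 := by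
  rw [eigvec, Matrix.mulVec_mulVec, eigvecs_transpose_mul, Matrix.one_mulVec]

theorem eigvec_dotProduct_self (hK : K.IsHermitian) (i : Fin n) :
    eigvec hK i ⬝ᵥ eigvec hK i = 1 := by
  rw [dotProduct_eq_eigvecs hK, eigvecs_transpose_mulVec_eigvec]
  simp

theorem eigvec_dotProduct (hK : K.IsHermitian) (i : Fin n) (v : Fin n → ℝ) :
    eigvec hK i ⬝ᵥ v = ((eigvecs hK)ᵀ *ᵥ v) i := by
  rw [dotProduct_eq_eigvecs hK, eigvecs_transpose_mulVec_eigvec]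
  simp

/-- The basis belongs to `K` while `M` is arbitrary, so `tr(Δ⁴)` can be tested on eigenvectors of
the kernel matrix. -/
theorem trace_eq_sum_eigvec (hK : K.IsHermitian) (M : Matrix (Fin n) (Fin n) ℝ) :
    M.trace = ∑ i, eigvec hK i ⬝ᵥ (M *ᵥ eigvec hK i) := by
  have h : M.trace = ((eigvecs hK)ᵀ * (M * eigvecs hK)).trace := by
    rw [Matrix.trace_mul_comm, Matrix.mul_assoc, eigvecs_mul_transpose, Matrix.mul_one]
  rw [h, Matrix.trace]
  refine Finset.sum_congr rfl fun i _ => ?_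
  rw [eigvec_dotProduct, eigvec, Matrix.mulVec_mulVec, Matrix.mulVec_mulVec, Matrix.mulVec_single_one,
    Matrix.mul_assoc]
  rfl

/-- Cauchy–Schwarz twice: `⟨u, Mu⟩² ≤ ‖Mu‖² = ⟨u, M²u⟩` and `⟨u, M²u⟩² ≤ ‖M²u‖² = ⟨u, M⁴u⟩`. -/
theorem quadForm_pow_four_ge {M : Matrix (Fin n) (Fin n) ℝ} (hM : Mᵀ = M) {u : Fin n → ℝ}
    (hu : u ⬝ᵥ u = 1) : (u ⬝ᵥ (M *ᵥ u)) ^ 4 ≤ u ⬝ᵥ (M ^ 4 *ᵥ u) := by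
  have h1 := dotProduct_sq_le u (M *ᵥ u)
  have h2 := dotProduct_sq_le u (M *ᵥ (M *ᵥ u))
  have h3 : (M *ᵥ u) ⬝ᵥ (M *ᵥ u) = u ⬝ᵥ (M *ᵥ (M *ᵥ u)) := by
    rw [dotProduct_mulVec_eq_transpose M u, hM]
  have h4 : u ⬝ᵥ (M ^ 4 *ᵥ u) = (M *ᵥ (M *ᵥ u)) ⬝ᵥ (M *ᵥ (M *ᵥ u)) := by
    have : M ^ 4 = M * (M * (M * M)) := by noncomm_ring
    rw [this]
    simp only [← Matrix.mulVec_mulVec]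
    rw [dotProduct_mulVec_eq_transpose M u, hM, dotProduct_mulVec_eq_transpose M (M *ᵥ u), hM]
  rw [hu, one_mul] at h1 h2
  rw [h4]
  rw [h3] at h1
  refine le_trans ?_ h2
  nlinarith [sq_nonneg (u ⬝ᵥ (M *ᵥ u))]

/-- The quadratic form of `Δ` is bounded below at every leading eigenvector of `K`. -/
theorem quadForm_hatMatrix_eigvec_ge (hK : K.PosSemidef) {S : Matrix (Fin s) (Fin n) ℝ}
    {lam c : ℝ} (hlam : 0 < lam) (hS : KSatisfiable hK.1 lam c S)
    (i : Fin n) (hi : lam < hK.1.eigenvalues i) :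
    (2 + 4 * c ^ 2)⁻¹ ≤ eigvec hK.1 i ⬝ᵥ (hatMatrix K S lam *ᵥ eigvec hK.1 i) := by
  set d := hK.1.eigenvalues with hd
  obtain ⟨hS1, hS2⟩ := hS
  set i' : {i : Fin n // lam < hK.1.eigenvalues i} := ⟨i, hi⟩ with hi'
  have hdi : 0 < d i := hlam.trans hi
  -- The test vector is `β = S U₁ g` with `(SU₁)ᵀ(SU₁) g = dᵢ⁻¹ eᵢ`. Then `K Sᵀ β` has coordinate
  -- `1` at `i` and `0` at every other leading eigenvector; only the tail coordinates remain to be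
  -- controlled.
  obtain ⟨g, hg, hg2⟩ := exists_mulVec_eq_of_opNorm_sub_one_le _ hS1 (Pi.single i' (d i)⁻¹)
  set β := (S * topEigvecs hK.1 lam) *ᵥ g with hβ
  set z := Sᵀ *ᵥ β with hz
  set η := (eigvecs hK.1)ᵀ *ᵥ z with hη
  have hββ : β ⬝ᵥ β ≤ 2 * ((d i)⁻¹) ^ 2 := by
    have : β ⬝ᵥ β = g ⬝ᵥ (Pi.single i' (d i)⁻¹) := by
      rw [← hg, ← Matrix.mulVec_mulVec, ← hβ, dotProduct_comm g,
        ← dotProduct_mulVec_eq_transpose]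
    rw [this]
    refine hg2.trans (le_of_eq ?_)
    simp [pow_two]
  have htop : ∀ j : {i : Fin n // lam < hK.1.eigenvalues i},
      η j.1 = (Pi.single i' (d i)⁻¹ : _ → ℝ) j := by
    intro j
    rw [← hg, ← Matrix.mulVec_mulVec, ← hβ, Matrix.transpose_mul, ← Matrix.mulVec_mulVec]
    rfl
  have hηi : η i = (d i)⁻¹ := by simpa using htop i'
  have hη0 : ∀ j, lam < d j → j ≠ i → η j = 0 := by
    intro j hj hji
    rw [htop ⟨j, hj⟩]
    exact Pi.single_eq_of_ne (fun h => hji (congrArg Subtype.val h)) _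
  set q := ∑ j : {i : Fin n // hK.1.eigenvalues i ≤ lam}, d j.1 * η j.1 ^ 2 with hq
  have hdnn : ∀ j, 0 ≤ d j := fun j => hK.eigenvalues_nonneg j
  -- The tail energy `q` is `‖(S U₂ D₂^{1/2})ᵀ β‖²`, bounded by the second half of satisfiability.
  have hqle : q ≤ c ^ 2 * lam * (β ⬝ᵥ β) := by
    have h := transpose_mulVec_dotProduct_self_le _ hS2 β
    rw [mul_pow, Real.sq_sqrt hlam.le] at h
    refine le_trans (le_of_eq ?_) h
    rw [hq]
    refine Finset.sum_congr rfl fun j _ => ?_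
    have : (((S * botEigvecs hK.1 lam * botSqrt hK.1 lam)ᵀ) *ᵥ β) j = √(d j.1) * η j.1 := by
      rw [Matrix.transpose_mul, Matrix.transpose_mul, botSqrt, Matrix.diagonal_transpose,
        ← Matrix.mulVec_mulVec, Matrix.mulVec_diagonal, ← Matrix.mulVec_mulVec]
      rfl
    rw [this, ← pow_two, mul_pow, Real.sq_sqrt (hdnn _)]
  have hlamq : lam * q ≤ 2 * c ^ 2 := by
    have h1 : lam * (d i)⁻¹ ≤ 1 := by
      rw [← div_eq_mul_inv]; exact (div_le_one hdi).2 hi.le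
    have h1' : 0 ≤ lam * (d i)⁻¹ := by positivity
    have h2 : (lam * (d i)⁻¹) ^ 2 ≤ 1 := pow_le_one₀ h1' h1
    calc lam * q ≤ lam * (c ^ 2 * lam * (2 * ((d i)⁻¹) ^ 2)) := by gcongr; exact hqle.trans (by gcongr)
      _ = 2 * c ^ 2 * (lam * (d i)⁻¹) ^ 2 := by ring
      _ ≤ 2 * c ^ 2 * 1 := by gcongr
      _ = 2 * c ^ 2 := mul_one _
  have hsplit : ∀ f : ℝ → ℝ, ∑ j, f (d j) * η j ^ 2 = f (d i) * (d i)⁻¹ ^ 2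
      + ∑ j : {i : Fin n // hK.1.eigenvalues i ≤ lam}, f (d j.1) * η j.1 ^ 2 := by
    intro f
    rw [← Finset.sum_filter_add_sum_filter_not Finset.univ (fun j => lam < d j)]
    congr 1
    · rw [Finset.sum_eq_single i, hηi]
      · intro j hj hji
        rw [hη0 j (by simpa using hj) hji]; simp
      · intro h; exact absurd hi (by simpa using h)
    · rw [← Finset.sum_subtype_eq_sum_filter]
      refine Finset.sum_bij' (fun j hj => ⟨j.1, not_lt.1 j.2⟩) (fun j _ => ⟨j.1, not_lt.2 j.2⟩)
        ?_ ?_ ?_ ?_ ?_ <;> simp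
  -- Coordinate `i` contributes `1` from `K²` and `λ / dᵢ ≤ 1` from the penalty; the tail
  -- contributes at most `λ q ≤ 2c²` to each.
  have hA : β ⬝ᵥ (normalMatrix K S lam *ᵥ β) ≤ 2 + 4 * c ^ 2 := by
    rw [normalMatrix_quadForm hK, ← hz, mulVec_dotProduct_self_eq_sum hK.1, quadForm_eq_sum hK.1]
    have h1 := hsplit (fun t => t ^ 2)
    have h2 := hsplit (fun t => t)
    rw [← hη, h1, h2]
    have h3 : ∑ j : {i : Fin n // hK.1.eigenvalues i ≤ lam}, d j.1 ^ 2 * η j.1 ^ 2 ≤ lam * q := by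
      rw [hq, Finset.mul_sum]
      refine Finset.sum_le_sum fun j _ => ?_
      have := mul_le_mul_of_nonneg_right j.2 (mul_nonneg (hdnn j.1) (sq_nonneg (η j.1)))
      calc d j.1 ^ 2 * η j.1 ^ 2 = d j.1 * (d j.1 * η j.1 ^ 2) := by ring
        _ ≤ _ := this
    have h4 : d i ^ 2 * (d i)⁻¹ ^ 2 = 1 := by field_simp
    have h5 : lam * (d i * (d i)⁻¹ ^ 2) ≤ 1 := by
      have : lam * (d i * (d i)⁻¹ ^ 2) = lam / d i := by field_simp
      rw [this]
      exact (div_le_one hdi).2 hi.le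
    rw [mul_add]
    linarith
  have hw : eigvec hK.1 i ⬝ᵥ (K *ᵥ z) = 1 := by
    rw [eigvec_dotProduct, eigvecs_transpose_mulVec_mulVec, ← hη, hηi, ← hd]
    field_simp
  -- With `Q ≤ 1/t` the normal form at `β`, the variational bound at `t • β` is `2t - t²Q ≥ t`.
  set t := (2 + 4 * c ^ 2)⁻¹ with ht
  have hpos : (0 : ℝ) < 2 + 4 * c ^ 2 := by positivity
  have h := hatMatrix_quadForm_ge (S := S) hK hlam.le (eigvec hK.1 i) (t • β)
  simp only [Matrix.mulVec_smul, dotProduct_smul, smul_dotProduct, smul_eq_mul] at h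
  rw [← hz, hw] at h
  have h6 : t * (t * (β ⬝ᵥ (normalMatrix K S lam *ᵥ β))) ≤ t := by
    have ht0 : 0 < t := by positivity
    calc t * (t * (β ⬝ᵥ (normalMatrix K S lam *ᵥ β))) ≤ t * (t * (2 + 4 * c ^ 2)) := by gcongr
      _ = t := by rw [ht]; field_simp
  linarith

/-- `tr(Δ⁴)` is at least a multiple of the number of leading eigenvalues of `K`. -/
theorem card_le_trace_hatMatrix_pow_four (hK : K.PosSemidef) {S : Matrix (Fin s) (Fin n) ℝ}
    {lam c : ℝ} (hlam : 0 < lam) (hS : KSatisfiable hK.1 lam c S) :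
    (2 + 4 * c ^ 2)⁻¹ ^ 4 * Fintype.card {i : Fin n // lam < hK.1.eigenvalues i}
      ≤ (hatMatrix K S lam ^ 4).trace := by
  have hsymm := hatMatrix_transpose (S := S) (lam := lam) hK
  have hq : ∀ i, (eigvec hK.1 i ⬝ᵥ (hatMatrix K S lam *ᵥ eigvec hK.1 i)) ^ 4
      ≤ eigvec hK.1 i ⬝ᵥ (hatMatrix K S lam ^ 4 *ᵥ eigvec hK.1 i) := fun i =>
    quadForm_pow_four_ge hsymm (eigvec_dotProduct_self hK.1 i)
  rw [trace_eq_sum_eigvec hK.1, Fintype.card_subtype, mul_comm, ← nsmul_eq_mul]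
  calc _ ≤ ∑ i with lam < hK.1.eigenvalues i,
        eigvec hK.1 i ⬝ᵥ (hatMatrix K S lam ^ 4 *ᵥ eigvec hK.1 i) := by
        refine Finset.card_nsmul_le_sum _ _ _ fun i hi => le_trans ?_ (hq i)
        exact pow_le_pow_left₀ (by positivity)
          (quadForm_hatMatrix_eigvec_ge hK hlam hS i (by simpa using hi)) 4
    _ ≤ _ := by
        refine Finset.sum_le_sum_of_subset_of_nonneg (Finset.subset_univ _) fun i _ _ => ?_
        exact le_trans (by positivity) (hq i)

/-- If the quadratic form of `K` exceeds `λ` on an `M`-dimensional space, then at least `M`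
eigenvalues of `K` exceed `λ`. -/
theorem le_card_eigenvalues_of_quadForm (hK : K.IsHermitian) {M : ℕ} {lam : ℝ}
    (Φ : Matrix (Fin n) (Fin M) ℝ)
    (hΦ : ∀ a, a ≠ 0 → lam * ((Φ *ᵥ a) ⬝ᵥ (Φ *ᵥ a)) < (Φ *ᵥ a) ⬝ᵥ (K *ᵥ (Φ *ᵥ a))) :
    M ≤ Fintype.card {i : Fin n // lam < hK.eigenvalues i} := by
  by_contra hlt
  push Not at hlt
  -- Courant–Fischer by counting dimensions: with fewer than `M` leading eigenvectors, some nonzero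
  -- `a` has `Φa` orthogonal to all of them.
  obtain ⟨a, ha, ha0⟩ : ∃ a : Fin M → ℝ,
      ((topEigvecs hK lam)ᵀ * Φ).mulVecLin a = 0 ∧ a ≠ 0 := by
    by_contra hno
    push Not at hno
    have hinj := (injective_iff_map_eq_zero ((topEigvecs hK lam)ᵀ * Φ).mulVecLin).2 hno
    have := LinearMap.finrank_le_finrank_of_injective hinj
    simp at this
    omega
  have h := hΦ a ha0
  set v := Φ *ᵥ a with hv
  have hη : ∀ j, lam < hK.eigenvalues j → ((eigvecs hK)ᵀ *ᵥ v) j = 0 := by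
    intro j hj
    have := congrFun ha ⟨j, hj⟩
    rw [Matrix.mulVecLin_apply, ← Matrix.mulVec_mulVec, ← hv] at this
    exact this
  refine absurd h (not_lt.2 ?_)
  rw [quadForm_eq_sum hK, dotProduct_eq_eigvecs hK v v, dotProduct, Finset.mul_sum]
  refine Finset.sum_le_sum fun j _ => ?_
  by_cases hj : lam < hK.eigenvalues j
  · simp [hη j hj]
  · rw [pow_two]
    exact mul_le_mul_of_nonneg_right (not_lt.1 hj) (mul_self_nonneg _)

end Spectral

/-! ### Mercer expansion on the sample and the weak law for the Gram matrix -/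

section Gram

variable {𝒳 : Type*} [MeasurableSpace 𝒳] {H : Type*} [NormedAddCommGroup H]
  [InnerProductSpace ℝ H] [CompleteSpace H] [RKHS ℝ H 𝒳 ℝ] {PX : Measure 𝒳} {μ : ℕ → ℝ}
  {φ : ℕ → H} {n : ℕ}

/-- The summands are nonnegative, so this yields positive semidefiniteness and, by truncation, lower
bounds on the quadratic form. -/
theorem IsMercerExpansion.hasSum_quadForm (h : IsMercerExpansion H PX μ φ) (x : Fin n → 𝒳)
    (v : Fin n → ℝ) :
    HasSum (fun k => (n : ℝ)⁻¹ * (μ k * (∑ i, v i * φ k (x i)) ^ 2))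
      (v ⬝ᵥ (kernelMatrix H x *ᵥ v)) := by
  have h1 : HasSum (fun k => ∑ i, ∑ j, v i * ((n : ℝ)⁻¹ * (μ k * φ k (x i) * φ k (x j)) * v j))
      (∑ i, ∑ j, v i * ((n : ℝ)⁻¹ * kern H (x i) (x j) * v j)) :=
    hasSum_sum fun i _ => hasSum_sum fun j _ =>
      (((h.expansion (x i) (x j)).mul_left _).mul_right _).mul_left _
  have h2 : v ⬝ᵥ (kernelMatrix H x *ᵥ v)
      = ∑ i, ∑ j, v i * ((n : ℝ)⁻¹ * kern H (x i) (x j) * v j) := by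
    simp [dotProduct, Matrix.mulVec, kernelMatrix, Finset.mul_sum]
  rw [h2]
  convert h1 using 2 with k
  rw [pow_two, Finset.sum_mul_sum, Finset.mul_sum, Finset.mul_sum]
  refine Finset.sum_congr rfl fun i _ => ?_
  rw [Finset.mul_sum, Finset.mul_sum]
  exact Finset.sum_congr rfl fun j _ => by ring

theorem IsMercerExpansion.kernelMatrix_posSemidef (h : IsMercerExpansion H PX μ φ)
    (x : Fin n → 𝒳) : (kernelMatrix H x).PosSemidef := by
  refine Matrix.PosSemidef.of_dotProduct_mulVec_nonneg (kernelMatrix_isHermitian H x) fun v => ?_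
  rw [star_trivial]
  refine (h.hasSum_quadForm x v).nonneg fun k => ?_
  have := (h.pos k).le
  positivity

/-- The empirical inner product of two eigenfunctions. -/
noncomputable def empGram (φ : ℕ → H) (x : Fin n → 𝒳) (k l : ℕ) : ℝ :=
  (n : ℝ)⁻¹ * ∑ i, φ k (x i) * φ l (x i)

/-- If the first `M` eigenfunctions are nearly orthonormal on the sample, then the kernel matrix
has at least `M` eigenvalues above any level below `μ_M / 2`. -/
theorem IsMercerExpansion.le_card_eigenvalues (h : IsMercerExpansion H PX μ φ) (x : Fin n → 𝒳)
    (hn : 0 < n) {M : ℕ} (hM : 0 < M) {lam : ℝ} (hlam : lam < μ (M - 1) / 2)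
    (hG : ∀ k < M, ∀ l < M, |empGram φ x k l - if k = l then 1 else 0| ≤ 1 / (2 * M)) :
    M ≤ Fintype.card {i : Fin n // lam < (kernelMatrix_isHermitian H x).eigenvalues i} := by
  set Φ : Matrix (Fin n) (Fin M) ℝ := Matrix.of fun i k => φ k (x i) with hΦ
  have hn' : (0 : ℝ) < n := by exact_mod_cast hn
  have hM' : (0 : ℝ) < M := by exact_mod_cast hM
  refine le_card_eigenvalues_of_quadForm _ Φ fun a ha => ?_
  set v := Φ *ᵥ a with hv
  have haa : 0 < a ⬝ᵥ a := lt_of_le_of_ne (dotProduct_self_nonneg' a)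
    (fun h0 => ha (dotProduct_self_eq_zero.1 h0.symm))
  -- The empirical Gram matrix has quadratic form within half that of the identity: entry errors
  -- `1/(2M)` combine with `(∑|aₖ|)² ≤ M ∑ aₖ²`.
  have hvv : n / 2 * (a ⬝ᵥ a) ≤ v ⬝ᵥ v := by
    have e1 : v ⬝ᵥ v = n * ∑ k, ∑ l, a k * a l * empGram φ x k l := by
      have : ∀ k l : Fin M, n * (a k * a l * empGram φ x k l)
          = ∑ i, (Φ i k * a k) * (Φ i l * a l) := by
        intro k l
        rw [empGram, Finset.mul_sum, Finset.mul_sum, Finset.mul_sum]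
        refine Finset.sum_congr rfl fun i _ => ?_
        simp only [hΦ, Matrix.of_apply]
        field_simp
      simp only [Finset.mul_sum, this]
      rw [hv]
      simp only [dotProduct, Matrix.mulVec]
      simp_rw [Finset.sum_mul_sum]
      rw [Finset.sum_comm]
      refine Finset.sum_congr rfl fun k _ => ?_
      rw [Finset.sum_comm]
    have e2 : a ⬝ᵥ a = ∑ k, ∑ l : Fin M, a k * a l * (if (k : ℕ) = l then 1 else 0) := by
      refine Finset.sum_congr rfl fun k _ => ?_
      simp [Fin.val_inj]
    have e3 : |∑ k, ∑ l : Fin M, a k * a l * (empGram φ x k l - if (k : ℕ) = l then 1 else 0)|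
        ≤ 1 / 2 * (a ⬝ᵥ a) := by
      calc _ ≤ ∑ k, ∑ l : Fin M, |a k| * |a l| * (1 / (2 * M)) := by
            refine (Finset.abs_sum_le_sum_abs _ _).trans (Finset.sum_le_sum fun k _ => ?_)
            refine (Finset.abs_sum_le_sum_abs _ _).trans (Finset.sum_le_sum fun l _ => ?_)
            rw [abs_mul, abs_mul]
            exact mul_le_mul_of_nonneg_left (hG k k.2 l l.2) (by positivity)
        _ = (∑ k, |a k|) ^ 2 * (1 / (2 * M)) := by
            rw [pow_two, Finset.sum_mul_sum, Finset.sum_mul]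
            simp_rw [Finset.sum_mul]
        _ ≤ (M * ∑ k, |a k| ^ 2) * (1 / (2 * M)) := by
            gcongr
            simpa using sq_sum_le_card_mul_sum_sq (s := Finset.univ) (f := fun k => |a k|)
        _ = 1 / 2 * (a ⬝ᵥ a) := by
            have : a ⬝ᵥ a = ∑ k, |a k| ^ 2 := by simp [dotProduct, pow_two]
            rw [this]
            field_simp
    have e4 : ∑ k, ∑ l : Fin M, a k * a l * empGram φ x k l = (a ⬝ᵥ a)
        + ∑ k, ∑ l : Fin M, a k * a l * (empGram φ x k l - if (k : ℕ) = l then 1 else 0) := by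
      rw [e2, ← Finset.sum_add_distrib]
      refine Finset.sum_congr rfl fun k _ => ?_
      rw [← Finset.sum_add_distrib]
      exact Finset.sum_congr rfl fun l _ => by ring
    rw [e1, e4]
    have := (abs_le.1 e3).1
    nlinarith
  have hvpos : 0 < v ⬝ᵥ v := lt_of_lt_of_le (by positivity) hvv
  set p := Φᵀ *ᵥ v with hp
  -- From `‖v‖² = ⟨a, p⟩ ≤ ‖a‖ ‖p‖` and the bound on `‖a‖²` just proved.
  have hpp : n / 2 * (v ⬝ᵥ v) ≤ p ⬝ᵥ p := by
    have e1 : v ⬝ᵥ v = a ⬝ᵥ p := by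
      rw [dotProduct_comm a, hp, ← dotProduct_mulVec_eq_transpose]
    have e2 := dotProduct_sq_le a p
    rw [← e1] at e2
    have e3 := dotProduct_self_nonneg' p
    have e4 : n / 2 * (v ⬝ᵥ v) * (v ⬝ᵥ v) ≤ (p ⬝ᵥ p) * (v ⬝ᵥ v) := by
      calc n / 2 * (v ⬝ᵥ v) * (v ⬝ᵥ v) = n / 2 * (v ⬝ᵥ v) ^ 2 := by ring
        _ ≤ n / 2 * ((a ⬝ᵥ a) * (p ⬝ᵥ p)) := by gcongr
        _ = (n / 2 * (a ⬝ᵥ a)) * (p ⬝ᵥ p) := by ring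
        _ ≤ (v ⬝ᵥ v) * (p ⬝ᵥ p) := by gcongr
        _ = _ := mul_comm _ _
    exact le_of_mul_le_mul_right e4 hvpos
  -- Only the first `M` Mercer terms are kept, each with eigenvalue at least `μ (M - 1)`.
  have hK : (n : ℝ)⁻¹ * (μ (M - 1) * (p ⬝ᵥ p)) ≤ v ⬝ᵥ (kernelMatrix H x *ᵥ v) := by
    have e1 := (h.hasSum_quadForm x v)
    refine le_trans ?_ (sum_le_hasSum (Finset.range M) (fun k _ => ?_) e1)
    · rw [Finset.sum_range, dotProduct, Finset.mul_sum, Finset.mul_sum]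
      refine Finset.sum_le_sum fun k _ => ?_
      have : ∑ i, v i * φ k (x i) = p k := by
        rw [hp]
        simp [Matrix.mulVec, dotProduct, hΦ, mul_comm]
      rw [this, ← pow_two]
      have hk : μ (M - 1) ≤ μ k := h.antitone (Nat.le_sub_one_of_lt k.2)
      gcongr
    · have := (h.pos k).le
      positivity
  refine lt_of_lt_of_le ?_ hK
  have hμ := h.pos (M - 1)
  calc lam * (v ⬝ᵥ v) < μ (M - 1) / 2 * (v ⬝ᵥ v) := by gcongr
    _ = (n : ℝ)⁻¹ * (μ (M - 1) * (n / 2 * (v ⬝ᵥ v))) := by field_simp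
    _ ≤ _ := by gcongr

/-- Weak law of large numbers for the empirical inner products of the eigenfunctions. -/
theorem IsMercerExpansion.measure_empGram_le [IsProbabilityMeasure PX]
    (h : IsMercerExpansion H PX μ φ) {C : ℝ}
    (hC : ∀ k, ∀ a : 𝒳, |φ k a| ≤ C) {Ω : Type*} [MeasurableSpace Ω] (P : Measure Ω)
    [IsProbabilityMeasure P] (x : Ω → Fin n → 𝒳) (hx : Measurable x)
    (hx_law : ∀ i, P.map (fun ω => x ω i) = PX) (hx_indep : iIndepFun (fun i ω => x ω i) P)
    (hn : 0 < n) (k l : ℕ) {η : ℝ} (hη : 0 < η) :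
    P {ω | η ≤ |empGram φ (x ω) k l - if k = l then 1 else 0|}
      ≤ ENNReal.ofReal (C ^ 4 / (n * η ^ 2)) := by
  have hn' : (0 : ℝ) < n := by exact_mod_cast hn
  have hxi : ∀ i, Measurable fun ω => x ω i := fun i => (measurable_pi_apply i).comp hx
  set g : 𝒳 → ℝ := fun a => φ k a * φ l a with hg
  have hgm : Measurable g := (h.measurable k).mul (h.measurable l)
  have hgC : ∀ a, |g a| ≤ C ^ 2 := by
    intro a
    rw [hg, pow_two, abs_mul]
    exact mul_le_mul (hC k a) (hC l a) (abs_nonneg _) ((abs_nonneg _).trans (hC k a))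
  set X : Fin n → Ω → ℝ := fun i ω => g (x ω i) with hX
  have hXm : ∀ i, Measurable (X i) := fun i => hgm.comp (hxi i)
  have hXL : ∀ i, MemLp (X i) 2 P := fun i =>
    MemLp.of_bound (hXm i).aestronglyMeasurable (C ^ 2) (ae_of_all _ fun ω => hgC _)
  have hvar : ∀ i, Var[X i; P] ≤ C ^ 4 := by
    intro i
    refine (variance_le_expectation_sq (hXm i).aestronglyMeasurable).trans ?_
    calc P[X i ^ 2] ≤ ∫ _, C ^ 4 ∂P := by
          refine integral_mono_of_nonneg (ae_of_all _ fun ω => sq_nonneg _) (integrable_const _)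
            (ae_of_all _ fun ω => ?_)
          calc (X i ω) ^ 2 = |X i ω| ^ 2 := (sq_abs _).symm
            _ ≤ (C ^ 2) ^ 2 := pow_le_pow_left₀ (abs_nonneg _) (hgC _) 2
            _ = C ^ 4 := by ring
      _ = C ^ 4 := by simp
  have hmean : ∀ i, P[X i] = if k = l then 1 else 0 := by
    intro i
    rw [← h.orthonormal_L2 k l, ← hx_law i,
      integral_map (hxi i).aemeasurable hgm.aestronglyMeasurable]
  have hXind : iIndepFun X P := hx_indep.comp (fun _ => g) fun _ => hgm
  have hsumvar : Var[∑ i, X i; P] ≤ n * C ^ 4 := by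
    rw [IndepFun.variance_sum (fun i _ => hXL i) fun i _ j _ hij => hXind.indepFun hij]
    refine (Finset.sum_le_sum fun i _ => hvar i).trans ?_
    simp
  have hfun : (fun ω => empGram φ (x ω) k l) = fun ω => (n : ℝ)⁻¹ * (∑ i, X i) ω := by
    funext ω
    simp [empGram, hX, hg]
  have hL : MemLp (fun ω => (n : ℝ)⁻¹ * (∑ i, X i) ω) 2 P :=
    (memLp_finsetSum' _ fun i _ => hXL i).const_mul _
  have hexp : P[fun ω => (n : ℝ)⁻¹ * (∑ i, X i) ω] = if k = l then 1 else 0 := by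
    rw [integral_const_mul]
    simp only [Finset.sum_apply]
    rw [integral_finsetSum _ fun i _ => (hXL i).integrable (by norm_num)]
    simp only [hmean, Finset.sum_const, Finset.card_univ, Fintype.card_fin, nsmul_eq_mul]
    field_simp
  have hcheb := meas_ge_le_variance_div_sq hL hη
  rw [hexp] at hcheb
  have hset : {ω | η ≤ |empGram φ (x ω) k l - if k = l then 1 else 0|}
      = {ω | η ≤ |(n : ℝ)⁻¹ * (∑ i, X i) ω - if k = l then 1 else 0|} := by
    ext ω
    simp only [Set.mem_ofPred_eq]
    rw [congrFun hfun ω]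
  rw [hset]
  refine hcheb.trans (ENNReal.ofReal_le_ofReal ?_)
  rw [variance_const_mul]
  calc (n : ℝ)⁻¹ ^ 2 * Var[∑ i, X i; P] / η ^ 2 ≤ (n : ℝ)⁻¹ ^ 2 * (n * C ^ 4) / η ^ 2 := by gcongr
    _ = C ^ 4 / (n * η ^ 2) := by field_simp

end Gram

/-! ### Exceptional probabilities and divergence of the effective dimension -/

theorem exp_neg_coe_lt_one {a : ℝ≥0∞} (ha : 0 < a) : EReal.exp (-(a : EReal)) < 1 := by
  rw [← EReal.exp_zero]
  refine EReal.exp_strictMono ?_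
  rw [EReal.neg_lt_zero]
  exact_mod_cast ha

/-- An event of `(a, b)`-type has probability at least `1 - exp(-a) - exp(-b)`. -/
theorem IsOfType.measure_compl_le {Ω β : Type*} [MeasurableSpace Ω] [mβ : MeasurableSpace β]
    {P : Measure Ω} [IsProbabilityMeasure P] {x : Ω → β} (hx : Measurable x) {E : Set Ω}
    {a b : ℝ≥0∞} (h : IsOfType P x E a b) (ha : 0 < a) (hb : 0 < b) :
    P Eᶜ ≤ EReal.exp (-(a : EReal)) + EReal.exp (-(b : EReal)) := by
  set p := EReal.exp (-(a : EReal)) with hp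
  set r := EReal.exp (-(b : EReal)) with hr
  have hp1 : p < 1 := exp_neg_coe_lt_one ha
  have hr1 : r < 1 := exp_neg_coe_lt_one hb
  rw [IsOfType, ← hp, ← hr] at h
  set g := P⟦E | mβ.comap x⟧ with hg
  have hm : mβ.comap x ≤ ‹MeasurableSpace Ω› := hx.comap_le
  -- Measurability of `E` is not assumed. If the indicator is not integrable, the conditional
  -- probability defaults to `0`, and the type condition fails because `1 - r > 0`.
  by_cases hint : Integrable (E.indicator fun _ => (1 : ℝ)) P
  · have hEm : NullMeasurableSet E P := by
      have h1 := hint.aemeasurable.nullMeasurable (measurableSet_singleton (1 : ℝ))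
      convert h1 using 1
      ext ω
      by_cases hω : ω ∈ E <;> simp [hω]
    have hgm : Measurable g := (stronglyMeasurable_condExp.mono hm).measurable
    have hg0 : 0 ≤ᵐ[P] g := condExp_nonneg (ae_of_all _ fun ω => Set.indicator_nonneg
      (fun _ _ => zero_le_one) ω)
    have hgint : ∫ ω, g ω ∂P = P.real E := by
      rw [hg, integral_condExp hm, integral_indicator₀ hEm]
      simp
    have hPE : P E = ∫⁻ ω, ENNReal.ofReal (g ω) ∂P := by
      rw [← ofReal_integral_eq_lintegral_ofReal integrable_condExp hg0, hgint, measureReal_def,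
        ENNReal.ofReal_toReal (measure_ne_top _ _)]
    -- Markov's inequality for the conditional probability.
    have hlow : (1 - p) * (1 - r) ≤ P E := by
      rw [hPE]
      refine le_trans ?_ (mul_meas_ge_le_lintegral hgm.ennreal_ofReal (1 - p))
      gcongr
    have hle : 1 - (p + r) ≤ P E := by
      refine le_trans ?_ hlow
      rw [ENNReal.mul_sub (fun _ _ => (tsub_le_self.trans_lt ENNReal.one_lt_top).ne), mul_one,
        ← tsub_add_eq_tsub_tsub]
      gcongr
      exact mul_le_of_le_one_left' tsub_le_self
    rw [prob_compl_eq_one_sub₀ hEm]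
    exact tsub_le_iff_tsub_le.1 hle
  · have hzero : g = 0 := condExp_of_not_integrable hint
    have hempty : {ω | 1 - p ≤ ENNReal.ofReal (g ω)} = ∅ := by
      ext ω
      simpa [hzero, tsub_eq_zero_iff_le] using hp1
    rw [hempty, measure_empty, nonpos_iff_eq_zero, tsub_eq_zero_iff_le] at h
    exact absurd hr1 (not_lt.2 h)

/-- Working in `ℝ≥0∞` covers `c = ∞` too: in every case the exponent tends to `∞`. -/
theorem tendsto_exp_neg_mul {c : ℝ≥0∞} (hc : 0 < c) {t : ℕ → ℕ} (ht : Tendsto t atTop atTop) :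
    Tendsto (fun n => EReal.exp (-((c * t n : ℝ≥0∞) : EReal))) atTop (𝓝 0) := by
  have h1 : Tendsto (fun n => c * (t n : ℝ≥0∞)) atTop (𝓝 (c * ⊤)) :=
    ENNReal.Tendsto.const_mul (ENNReal.tendsto_nat_nhds_top.comp ht) (Or.inl ENNReal.top_ne_zero)
  rw [ENNReal.mul_top hc.ne'] at h1
  have h2 := (ENNReal.continuous_exp.tendsto _).comp
    ((continuous_neg.tendsto _).comp ((continuous_coe_ennreal_ereal.tendsto _).comp h1))
  have h3 : EReal.exp (-((⊤ : ℝ≥0∞) : EReal)) = 0 := by simp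
  rw [h3] at h2
  exact h2

/-- Once `λ < μ M`, no index up to `M` qualifies. Summability makes the index set nonempty;
otherwise its infimum would be the default `0`. -/
theorem tendsto_effDim {μ : ℕ → ℝ} (hanti : Antitone μ) (hpos : ∀ k, 0 < μ k)
    (hsum : Summable μ) {lam : ℕ → ℝ} (hlam_pos : ∀ n, 0 < lam n) (hlam : Tendsto lam atTop (𝓝 0)) :
    Tendsto (fun n => effDim μ (lam n)) atTop atTop := by
  refine tendsto_atTop.2 fun M => ?_
  filter_upwards [hlam.eventually (gt_mem_nhds (hpos M))] with n hn
  refine le_csInf ?_ fun k hk => ?_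
  · obtain ⟨k, hk⟩ := (hsum.tendsto_atTop_zero.eventually (gt_mem_nhds (hlam_pos n))).exists
    exact ⟨k, hk.le⟩
  · by_contra hkM
    exact absurd (hanti (not_le.1 hkM).le) (not_le.2 (lt_of_le_of_lt hk hn))

/-! ### Divergence of the trace in probability -/

section Trace

variable {𝒳 : Type*} [MeasurableSpace 𝒳] {H : Type*} [NormedAddCommGroup H]
  [InnerProductSpace ℝ H] [CompleteSpace H] [RKHS ℝ H 𝒳 ℝ]

/-- `tr(Δ⁴)` diverges in probability. -/
theorem tendsto_measure_trace_hatMatrix_lt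
    (PX : Measure 𝒳) [IsProbabilityMeasure PX] (μ : ℕ → ℝ) (φ : ℕ → H)
    (hMercer : IsMercerExpansion H PX μ φ) (hRegular : EigenRegular H μ φ)
    (lam : ℕ → ℝ) (s : ℕ → ℕ) (hlam_pos : ∀ n, 0 < lam n)
    (hlam : Tendsto lam atTop (𝓝 0)) (hs : Tendsto s atTop atTop)
    {Ω : ℕ → Type*} [∀ n, MeasurableSpace (Ω n)] (P : ∀ n, Measure (Ω n))
    [∀ n, IsProbabilityMeasure (P n)]
    (x : ∀ n, Ω n → Fin n → 𝒳) (S : ∀ n, Ω n → Fin (s n) → Fin n → ℝ)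
    (hx : ∀ n, Measurable (x n))
    (hx_law : ∀ n i, (P n).map (fun ω => x n ω i) = PX)
    (hx_indep : ∀ n, iIndepFun (fun i ω => x n ω i) (P n))
    {c : ℝ} {c₁ c₂ : ℝ≥0∞} (hc₁ : 0 < c₁) (hc₂ : 0 < c₂)
    (hSat : ∀ᶠ n in atTop, IsOfType (P n) (x n)
        {ω | KSatisfiable (kernelMatrix_isHermitian H (x n ω)) (lam n) c (Matrix.of (S n ω))}
        (c₁ * s n) (c₂ * effDim μ (lam n))) (R : ℝ) :
    Tendsto (fun n => P n {ω |
      (hatMatrix (kernelMatrix H (x n ω)) (Matrix.of (S n ω)) (lam n) ^ 4).trace < R})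
      atTop (𝓝 0) := by
  obtain ⟨C, hC⟩ := hRegular.bounded
  set δ : ℝ := (2 + 4 * c ^ 2)⁻¹ ^ 4 with hδ
  have hδ0 : 0 < δ := by positivity
  -- `M` leading eigenvalues force `tr(Δ⁴) ≥ δM`, so `M` is taken with `δM > R`.
  obtain ⟨M₀, hM₀⟩ := exists_nat_gt (R / δ)
  set M := M₀ + 1 with hM
  have hMR : R < δ * M := by
    rw [div_lt_iff₀ hδ0] at hM₀
    rw [hM]
    push_cast
    nlinarith
  have hM0 : 0 < M := Nat.succ_pos _
  have hMr : (0 : ℝ) < M := by exact_mod_cast hM0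
  set η : ℝ := 1 / (2 * M) with hη
  have hη0 : 0 < η := by positivity
  have heff := tendsto_effDim hMercer.antitone hMercer.pos hRegular.summable hlam_pos hlam
  set B : ∀ n, ℕ × ℕ → Set (Ω n) := fun n q =>
    {ω | η ≤ |empGram φ (x n ω) q.1 q.2 - if q.1 = q.2 then 1 else 0|} with hB
  set I := Finset.range M ×ˢ Finset.range M with hI
  -- The union bound runs over a fixed number `M²` of Gram entries, so the Chebyshev terms vanish as
  -- `n` grows.
  have hlim : Tendsto (fun n : ℕ => (EReal.exp (-((c₁ * s n : ℝ≥0∞) : EReal))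
      + EReal.exp (-((c₂ * effDim μ (lam n) : ℝ≥0∞) : EReal)))
      + ∑ _q ∈ I, ENNReal.ofReal (C ^ 4 / (n * η ^ 2))) atTop (𝓝 0) := by
    have h1 := (tendsto_exp_neg_mul hc₁ hs).add (tendsto_exp_neg_mul hc₂ heff)
    have h2 : Tendsto (fun n : ℕ => C ^ 4 / ((n : ℝ) * η ^ 2)) atTop (𝓝 0) :=
      Tendsto.div_atTop tendsto_const_nhds
        (tendsto_natCast_atTop_atTop.atTop_mul_const (by positivity))
    have h3 : Tendsto (fun n : ℕ => ENNReal.ofReal (C ^ 4 / ((n : ℝ) * η ^ 2))) atTop (𝓝 0) := by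
      simpa using ENNReal.tendsto_ofReal h2
    simpa using h1.add (tendsto_finsetSum I fun _ _ => h3)
  refine tendsto_of_tendsto_of_tendsto_of_le_of_le' tendsto_const_nhds hlim
    (Eventually.of_forall fun n => zero_le) ?_
  filter_upwards [hSat, eventually_gt_atTop 0, hs.eventually_gt_atTop 0,
    heff.eventually_gt_atTop 0,
    hlam.eventually (gt_mem_nhds (half_pos (hMercer.pos (M - 1))))] with n hn hn0 hsn hen hln
  have hE := hn.measure_compl_le (hx n)
    (ENNReal.mul_pos hc₁.ne' (by exact_mod_cast hsn.ne'))
    (ENNReal.mul_pos hc₂.ne' (by exact_mod_cast hen.ne'))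
  refine le_trans (measure_mono ?_) ((measure_union_le _ (⋃ q ∈ I, B n q)).trans
    (add_le_add hE ((measure_biUnion_finset_le I _).trans (Finset.sum_le_sum fun q _ =>
      hMercer.measure_empGram_le hC (P n) (x n) (hx n) (hx_law n) (hx_indep n) hn0 q.1 q.2 hη0))))
  intro ω hω
  by_contra hno
  simp only [Set.mem_union, not_or, Set.mem_compl_iff, not_not, Set.mem_iUnion, not_exists] at hno
  obtain ⟨hS, hG⟩ := hno
  have hcard := hMercer.le_card_eigenvalues (x n ω) hn0 hM0 hln fun k hk l hl => by
    have := hG (k, l) (by simp [hI, hk, hl])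
    exact (not_le.1 this).le
  have htr := card_le_trace_hatMatrix_pow_four (hMercer.kernelMatrix_posSemidef (x n ω))
    (hlam_pos n) hS
  have hω' : (hatMatrix (kernelMatrix H (x n ω)) (Matrix.of (S n ω)) (lam n) ^ 4).trace < R := hω
  have : δ * M ≤ δ * Fintype.card
      {i : Fin n // lam n < (kernelMatrix_isHermitian H (x n ω)).eigenvalues i} := by
    gcongr
  linarith

end Trace

/-! ### Gaussian moments and the characteristic function of `χ²₁` -/

section Moments

theorem integral_sq_gaussianReal : ∫ z, z ^ 2 ∂(gaussianReal 0 1) = 1 := by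
  have h := variance_fun_id_gaussianReal (μ := 0) (v := 1)
  rw [variance_eq_integral (by fun_prop)] at h
  simpa using h

/-- By symmetry this is a half-line integral, evaluated through `Γ(5/2) = (3/4)√π`. -/
theorem integral_pow_four_gaussianReal : ∫ z, z ^ 4 ∂(gaussianReal 0 1) = 3 := by
  rw [integral_gaussianReal_eq_integral_smul one_ne_zero]
  have h1 : ∀ z : ℝ, gaussianPDFReal 0 1 z • z ^ 4
      = (fun u : ℝ => (√(2 * Real.pi))⁻¹ * (u ^ 4 * Real.exp (-(1 / 2) * u ^ 2))) |z| := by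
    intro z
    have e4 : |z| ^ 4 = z ^ 4 := by
      rw [show (4 : ℕ) = 2 * 2 from rfl, pow_mul, pow_mul, sq_abs]
    simp only [gaussianPDFReal, smul_eq_mul, sq_abs, e4, NNReal.coe_one, mul_one, sub_zero]
    rw [show -z ^ 2 / 2 = -(1 / 2) * z ^ 2 by ring]
    ring
  simp_rw [h1]
  rw [integral_comp_abs (f := fun u : ℝ =>
    (√(2 * Real.pi))⁻¹ * (u ^ 4 * Real.exp (-(1 / 2) * u ^ 2))), integral_const_mul]
  have h2 := integral_rpow_mul_exp_neg_mul_rpow (p := 2) (q := 4) (b := 1 / 2) (by norm_num)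
    (by norm_num) (by norm_num)
  have h3 : ∫ u in Set.Ioi (0 : ℝ), u ^ 4 * Real.exp (-(1 / 2) * u ^ 2)
      = ∫ u in Set.Ioi (0 : ℝ), u ^ (4 : ℝ) * Real.exp (-(1 / 2) * u ^ (2 : ℝ)) := by
    norm_cast
  have hG : Real.Gamma ((4 + 1) / 2) = 3 / 4 * √Real.pi := by
    have := Real.Gamma_nat_add_one_add_half 1
    norm_num [Nat.doubleFactorial] at this ⊢
    rw [this]
    ring
  have hpow : ((1 : ℝ) / 2) ^ (-(4 + 1) / 2 : ℝ) = 4 * √2 := by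
    rw [one_div, Real.inv_rpow (by norm_num), ← Real.rpow_neg (by norm_num),
      show (-(-(4 + 1) / 2) : ℝ) = 2 + 1 / 2 by norm_num, Real.rpow_add (by norm_num),
      ← Real.sqrt_eq_rpow]
    norm_num
  rw [h3, h2, hG, hpow, Real.sqrt_mul (by norm_num)]
  have : √Real.pi ≠ 0 := (Real.sqrt_pos.2 Real.pi_pos).ne'
  field_simp

theorem memLp_sq_gaussianReal : MemLp (fun z : ℝ => z ^ 2) 2 (gaussianReal 0 1) := by
  -- Integrability of `z ^ 4` follows from its integral being nonzero, since a nonintegrable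
  -- function has integral `0`.
  refine (memLp_two_iff_integrable_sq (by fun_prop)).2 (.of_integral_ne_zero ?_)
  simp_rw [← pow_mul]
  norm_num [integral_pow_four_gaussianReal]

theorem variance_sq_gaussianReal : Var[fun z : ℝ => z ^ 2; gaussianReal 0 1] = 2 := by
  rw [variance_eq_sub memLp_sq_gaussianReal, integral_sq_gaussianReal]
  have : ∫ z, ((fun z : ℝ => z ^ 2) ^ 2) z ∂(gaussianReal 0 1) = 3 := by
    rw [← integral_pow_four_gaussianReal]
    refine integral_congr_ae (ae_of_all _ fun z => ?_)
    simp only [Pi.pow_apply]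
    ring
  rw [this]
  norm_num

/-- The characteristic function of a standardized `χ²₁` variable agrees with the Gaussian one to
second order. -/
theorem charFun_chiSq_isLittleO :
    (fun t : ℝ => charFun ((gaussianReal 0 1).map fun z => (z ^ 2 - 1) / √2) t
      - Complex.exp (-(t : ℂ) ^ 2 / 2)) =o[𝓝 0] fun t => t ^ 2 := by
  have h1 := taylor_charFun_two (P := gaussianReal 0 1) (X := fun z => (z ^ 2 - 1) / √2)
    (by fun_prop)
    (by
      rw [integral_div, integral_sub (memLp_sq_gaussianReal.integrable (by norm_num))
        (integrable_const _), integral_sq_gaussianReal]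
      simp)
    (by
      have := variance_sq_gaussianReal
      rw [variance_eq_integral (by fun_prop), integral_sq_gaussianReal] at this
      have e : ∀ z : ℝ, ((fun z : ℝ => (z ^ 2 - 1) / √2) ^ 2) z = (z ^ 2 - 1) ^ 2 / 2 := by
        intro z
        simp [div_pow]
      simp_rw [e]
      rw [integral_div, this]
      norm_num)
  have h2 := taylor_charFun_two (P := gaussianReal 0 1) (X := fun z => z) (by fun_prop)
    (by simp) (by simpa using integral_sq_gaussianReal)
  have h3 := h1.sub h2
  refine h3.congr' (Eventually.of_forall fun t => ?_) (Eventually.of_forall fun t => rfl)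
  have : charFun ((gaussianReal 0 1).map fun z => z) t = Complex.exp (-(t : ℂ) ^ 2 / 2) := by
    rw [Measure.map_id', charFun_gaussianReal]
    congr 1
    simp
    ring
  simp only [this]
  ring

end Moments

/-- Factors in the unit disc are exchanged one at a time, so the errors add. -/
theorem norm_prod_sub_prod_le {ι : Type*} (I : Finset ι) (f g : ι → ℂ) (hf : ∀ i, ‖f i‖ ≤ 1)
    (hg : ∀ i, ‖g i‖ ≤ 1) : ‖∏ i ∈ I, f i - ∏ i ∈ I, g i‖ ≤ ∑ i ∈ I, ‖f i - g i‖ := by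
  classical
  induction I using Finset.induction_on with
  | empty => simp
  | insert a I ha ih =>
    rw [Finset.prod_insert ha, Finset.prod_insert ha, Finset.sum_insert ha]
    have e : f a * ∏ i ∈ I, f i - g a * ∏ i ∈ I, g i
        = (f a - g a) * ∏ i ∈ I, f i + g a * (∏ i ∈ I, f i - ∏ i ∈ I, g i) := by ring
    rw [e]
    refine (norm_add_le _ _).trans (add_le_add ?_ ?_)
    · rw [norm_mul, norm_prod]
      exact mul_le_of_le_one_right (norm_nonneg _)
        (Finset.prod_le_one (fun i _ => norm_nonneg _) fun i _ => hf i)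
    · rw [norm_mul]
      exact (mul_le_of_le_one_left (norm_nonneg _) (hg a)).trans ih

/-! ### Gaussian quadratic forms: moments and central limit theorem -/

section QuadForm

variable {n : ℕ} {D : Matrix (Fin n) (Fin n) ℝ}

/-- The law of a vector of `n` independent standard Gaussian variables. -/
noncomputable abbrev stdNormalPi (n : ℕ) : Measure (Fin n → ℝ) :=
  Measure.pi fun _ : Fin n => gaussianReal 0 1

/-- The coordinates of a standard Gaussian vector in an orthonormal eigenbasis are again standard
Gaussian. -/
theorem map_eigvecs_transpose_stdNormalPi (hD : D.IsHermitian) :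
    (stdNormalPi n).map (fun e => (eigvecs hD)ᵀ *ᵥ e) = stdNormalPi n := by
  have h1 := map_pi_eq_stdGaussian (ι := Fin n)
  have h2 := stdGaussian_map hD.eigenvectorBasis.repr
  have h3 : (stdGaussian (EuclideanSpace ℝ (Fin n))).map WithLp.ofLp = stdNormalPi n := by
    rw [← h1, Measure.map_map (by fun_prop) (by fun_prop)]
    exact Measure.map_id
  have h4 : (fun e => (eigvecs hD)ᵀ *ᵥ e)
      = WithLp.ofLp ∘ hD.eigenvectorBasis.repr ∘ WithLp.toLp 2 := by
    funext e i
    simp only [Function.comp_apply, OrthonormalBasis.repr_apply_apply, Matrix.mulVec, dotProduct,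
      Matrix.transpose_apply, Matrix.IsHermitian.eigenvectorUnitary_apply]
    simp [PiLp.inner_apply, mul_comm]
  rw [h4, ← Measure.map_map (by fun_prop) (by fun_prop),
    ← Measure.map_map (by fun_prop) (by fun_prop), h1, h2, h3]

theorem eigvecs_transpose_mulVec_pow_mulVec (hD : D.IsHermitian) (k : ℕ) (v : Fin n → ℝ)
    (j : Fin n) :
    ((eigvecs hD)ᵀ *ᵥ (D ^ k *ᵥ v)) j = hD.eigenvalues j ^ k * ((eigvecs hD)ᵀ *ᵥ v) j := by
  induction k with
  | zero => simp
  | succ k ih =>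
    rw [pow_succ', ← Matrix.mulVec_mulVec, eigvecs_transpose_mulVec_mulVec, ih]
    ring

theorem trace_pow_eq_sum (hD : D.IsHermitian) (k : ℕ) :
    (D ^ k).trace = ∑ j, hD.eigenvalues j ^ k := by
  rw [trace_eq_sum_eigvec hD]
  refine Finset.sum_congr rfl fun j _ => ?_
  rw [eigvec_dotProduct, eigvecs_transpose_mulVec_pow_mulVec, eigvecs_transpose_mulVec_eigvec]
  simp

/-- The statistic `n⁻¹ ‖D e‖²`. -/
noncomputable def quadStat (D : Matrix (Fin n) (Fin n) ℝ) (e : Fin n → ℝ) : ℝ :=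
  (n : ℝ)⁻¹ * ((D *ᵥ e) ⬝ᵥ (D *ᵥ e))

theorem quadStat_eq_sum (hD : D.IsHermitian) (e : Fin n → ℝ) :
    quadStat D e
      = ∑ j, (n : ℝ)⁻¹ * hD.eigenvalues j ^ 2 * ((eigvecs hD)ᵀ *ᵥ e) j ^ 2 := by
  rw [quadStat, mulVec_dotProduct_self_eq_sum hD, Finset.mul_sum]
  exact Finset.sum_congr rfl fun j _ => by ring

/-- Rotation invariance of the Gaussian law. A general `g` serves the mean, the variance and the
characteristic function alike. -/
theorem integral_comp_quadStat {F : Type*} [NormedAddCommGroup F] [NormedSpace ℝ F]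
    (hD : D.IsHermitian) {g : ℝ → F} (hg : Continuous g) :
    ∫ e, g (quadStat D e) ∂(stdNormalPi n)
      = ∫ z, g (∑ j, (n : ℝ)⁻¹ * hD.eigenvalues j ^ 2 * z j ^ 2) ∂(stdNormalPi n) := by
  conv_rhs => rw [← map_eigvecs_transpose_stdNormalPi hD]
  rw [integral_map]
  · simp_rw [quadStat_eq_sum hD]
  · exact Continuous.aemeasurable (by fun_prop)
  · exact Continuous.aestronglyMeasurable (by fun_prop)

theorem memLp_eval_sq (j : Fin n) : MemLp (fun z : Fin n → ℝ => z j ^ 2) 2 (stdNormalPi n) :=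
  memLp_sq_gaussianReal.comp_measurePreserving (measurePreserving_eval _ j)

theorem integral_quadStat (hD : D.IsHermitian) :
    ∫ e, quadStat D e ∂(stdNormalPi n) = nullMean D := by
  rw [integral_comp_quadStat (g := fun t => t) hD continuous_id, integral_finsetSum _ fun j _ =>
    ((memLp_eval_sq j).integrable (by norm_num)).const_mul _, nullMean, trace_pow_eq_sum hD,
    Finset.sum_div]
  refine Finset.sum_congr rfl fun j _ => ?_
  rw [integral_const_mul]
  have : ∫ z : Fin n → ℝ, z j ^ 2 ∂(stdNormalPi n) = 1 := by
    rw [← integral_sq_gaussianReal]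
    exact integral_comp_eval (μ := fun _ : Fin n => gaussianReal 0 1) (i := j)
      (f := fun z : ℝ => z ^ 2) (by fun_prop)
  rw [this]
  ring

theorem integral_quadStat_sub_sq (hD : D.IsHermitian) :
    ∫ e, (quadStat D e - nullMean D) ^ 2 ∂(stdNormalPi n) = nullVar D := by
  have hmean := integral_quadStat hD
  rw [integral_comp_quadStat (g := fun t => t) hD continuous_id] at hmean
  rw [integral_comp_quadStat (g := fun t => (t - nullMean D) ^ 2) hD (by fun_prop), ← hmean,
    ← variance_eq_integral (Continuous.aemeasurable (by fun_prop))]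
  have h := variance_sum_pi (μ := fun _ : Fin n => gaussianReal 0 1)
    (X := fun j (z : ℝ) => (n : ℝ)⁻¹ * hD.eigenvalues j ^ 2 * z ^ 2)
    fun j => memLp_sq_gaussianReal.const_mul _
  have e : (∑ j, fun z : Fin n → ℝ => (n : ℝ)⁻¹ * hD.eigenvalues j ^ 2 * z j ^ 2)
      = fun z => ∑ j, (n : ℝ)⁻¹ * hD.eigenvalues j ^ 2 * z j ^ 2 := by
    funext z
    simp
  rw [e] at h
  rw [h, nullVar, trace_pow_eq_sum hD, Finset.mul_sum, Finset.sum_div]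
  refine Finset.sum_congr rfl fun j _ => ?_
  rw [variance_const_mul, variance_sq_gaussianReal]
  ring

/-- Quantitative central limit theorem for Gaussian quadratic forms: the standardized statistic is
close to standard normal as soon as `tr(D⁴)` is large and `‖D‖ ≤ 1`. -/
theorem exists_norm_charFun_quadStat_sub_le (t : ℝ) {η : ℝ} (hη : 0 < η) :
    ∃ R : ℝ, ∀ (n : ℕ) (D : Matrix (Fin n) (Fin n) ℝ) (hD : D.IsHermitian),
      (∀ j, hD.eigenvalues j ^ 2 ≤ 1) → R ≤ (D ^ 4).trace →
      ‖∫ e, Complex.exp (t * ((quadStat D e - nullMean D) / √(nullVar D) : ℝ) * Complex.I)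
          ∂(stdNormalPi n) - Complex.exp (-(t : ℂ) ^ 2 / 2)‖ ≤ η := by
  set χ : ℝ → ℂ := charFun ((gaussianReal 0 1).map fun z => (z ^ 2 - 1) / √2) with hχ
  have hη' : 0 < η / (t ^ 2 + 1) := by positivity
  obtain ⟨r, hr, hχr⟩ := Metric.eventually_nhds_iff.1
    (charFun_chiSq_isLittleO.def hη')
  -- This `R` forces `|t * b j| < r` below, as `|b j| ≤ 1/√V`; the `+ 1` gives strictness and `V >
  -- 0`.
  refine ⟨(|t| / r + 1) ^ 2, fun n D hD hle htr => ?_⟩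
  set d := hD.eigenvalues with hd
  have htr' := trace_pow_eq_sum hD 4
  set V := (D ^ 4).trace with hV
  have hV0 : 0 < V := lt_of_lt_of_le (by positivity) htr
  have hn : (0 : ℝ) < n := by
    rcases Nat.eq_zero_or_pos n with rfl | h
    · simp [htr'] at hV0
    · exact_mod_cast h
  set b : Fin n → ℝ := fun j => d j ^ 2 / √V with hb
  have hsV : 0 < √V := Real.sqrt_pos.2 hV0
  have hb2 : ∑ j, b j ^ 2 = 1 := by
    simp only [hb, div_pow, Real.sq_sqrt hV0.le, ← pow_mul]
    rw [← Finset.sum_div, ← htr', div_self hV0.ne']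
  have hbr : ∀ j, |t * b j| < r := by
    intro j
    have h1 : |b j| ≤ 1 / √V := by
      rw [abs_of_nonneg (by positivity)]
      exact div_le_div_of_nonneg_right (hle j) hsV.le
    have h2 : |t| / r + 1 ≤ √V := Real.le_sqrt_of_sq_le htr
    have h3 : |t| < r * √V := by
      have : |t| / r < √V := by linarith
      rwa [div_lt_iff₀' hr] at this
    calc |t * b j| = |t| * |b j| := abs_mul _ _
      _ ≤ |t| * (1 / √V) := by gcongr
      _ = |t| / √V := by ring
      _ < r := (div_lt_iff₀ hsV).2 h3
  have hstd : ∀ u : ℝ, (u - nullMean D) / √(nullVar D)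
      = (n * u - ∑ j, d j ^ 2) / (√2 * √V) := by
    intro u
    have h1 : √(nullVar D) = √2 * √V / n := by
      rw [nullVar, ← hV, Real.sqrt_div (by positivity), Real.sqrt_mul (by norm_num),
        Real.sqrt_sq hn.le]
    rw [h1, nullMean, trace_pow_eq_sum hD, ← hd]
    have : √2 ≠ 0 := by positivity
    field_simp
  have hstd2 : ∀ z : Fin n → ℝ,
      (n * (∑ j, (n : ℝ)⁻¹ * d j ^ 2 * z j ^ 2) - ∑ j, d j ^ 2) / (√2 * √V)
        = ∑ j, b j * ((z j ^ 2 - 1) / √2) := by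
    intro z
    rw [Finset.mul_sum, ← Finset.sum_sub_distrib, Finset.sum_div]
    refine Finset.sum_congr rfl fun j _ => ?_
    simp only [hb]
    have : √2 ≠ 0 := by positivity
    field_simp
  have hchar : ∫ e, Complex.exp (t * ((quadStat D e - nullMean D) / √(nullVar D) : ℝ) * Complex.I)
      ∂(stdNormalPi n) = ∏ j, χ (t * b j) := by
    rw [integral_comp_quadStat
      (g := fun u => Complex.exp (t * ((u - nullMean D) / √(nullVar D) : ℝ) * Complex.I)) hD
      (by fun_prop)]
    have e1 : ∀ z : Fin n → ℝ, Complex.exp (t * ((∑ j, (n : ℝ)⁻¹ * d j ^ 2 * z j ^ 2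
        - nullMean D) / √(nullVar D) : ℝ) * Complex.I)
        = ∏ j, Complex.exp ((t * b j : ℝ) * ((z j ^ 2 - 1) / √2 : ℝ) * Complex.I) := by
      intro z
      rw [hstd, hstd2, ← Complex.exp_sum]
      congr 1
      rw [← Finset.sum_mul, Complex.ofReal_sum, Finset.mul_sum]
      congr 1
      exact Finset.sum_congr rfl fun j _ => by push_cast; ring
    simp_rw [← hd, e1]
    rw [integral_fintype_prod_eq_prod (μ := fun _ : Fin n => gaussianReal 0 1)
      (f := fun j z => Complex.exp ((t * b j : ℝ) * ((z ^ 2 - 1) / √2 : ℝ) * Complex.I))]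
    refine Finset.prod_congr rfl fun j _ => ?_
    rw [hχ, charFun_apply_real, integral_map (by fun_prop)
      (Continuous.aestronglyMeasurable (by fun_prop))]
  -- Because `∑ bⱼ² = 1`, the Gaussian limit factors along the same weights, and the products can be
  -- compared factor by factor.
  have hgauss : Complex.exp (-(t : ℂ) ^ 2 / 2) = ∏ j, Complex.exp (-((t * b j : ℝ) : ℂ) ^ 2 / 2) := by
    rw [← Complex.exp_sum]
    congr 1
    have : ((∑ j, b j ^ 2 : ℝ) : ℂ) = 1 := by rw [hb2]; simp
    rw [← mul_one (-(t : ℂ) ^ 2 / 2), ← this, Complex.ofReal_sum, Finset.mul_sum]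
    exact Finset.sum_congr rfl fun j _ => by push_cast; ring
  rw [hchar, hgauss]
  have hprob : IsProbabilityMeasure ((gaussianReal 0 1).map fun z : ℝ => (z ^ 2 - 1) / √2) :=
    Measure.isProbabilityMeasure_map (by fun_prop)
  refine (norm_prod_sub_prod_le Finset.univ _ _ (fun j => norm_charFun_le_one _) fun j => ?_).trans ?_
  · rw [Complex.norm_exp]
    have : (-((t * b j : ℝ) : ℂ) ^ 2 / 2).re = -(t * b j) ^ 2 / 2 := by
      rw [show (-((t * b j : ℝ) : ℂ) ^ 2 / 2) = ((-(t * b j) ^ 2 / 2 : ℝ) : ℂ) by push_cast; ring,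
        Complex.ofReal_re]
    rw [this]
    exact Real.exp_le_one_iff.2 (by nlinarith [sq_nonneg (t * b j)])
  · calc _ ≤ ∑ j, η / (t ^ 2 + 1) * (t * b j) ^ 2 := by
          refine Finset.sum_le_sum fun j _ => ?_
          have := hχr (y := t * b j) (by simpa [Real.dist_eq] using hbr j)
          rwa [Real.norm_of_nonneg (sq_nonneg _)] at this
      _ = η / (t ^ 2 + 1) * t ^ 2 * ∑ j, b j ^ 2 := by
          rw [Finset.mul_sum]
          exact Finset.sum_congr rfl fun j _ => by ring
      _ ≤ η := by
          rw [hb2, mul_one, div_mul_eq_mul_div, div_le_iff₀ (by positivity)]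
          nlinarith

end QuadForm

/-! ### Measurability of the hat matrix and the statistic -/

section Measurability

theorem symPinv_apply {n : ℕ} {A : Matrix (Fin n) (Fin n) ℝ} (hA : A.IsHermitian) (i j : Fin n) :
    symPinv A i j = ∑ l, eigvecs hA i l * (hA.eigenvalues l)⁻¹ * eigvecs hA j l := by
  have h : symPinv A
      = eigvecs hA * Matrix.diagonal (fun l => (hA.eigenvalues l)⁻¹) * (eigvecs hA)ᵀ := by
    rw [symPinv, hA.cfc_eq, Matrix.IsHermitian.cfc, Unitary.conjStarAlgAut_apply,
      Matrix.star_eq_conjTranspose, Matrix.conjTranspose_eq_transpose_of_trivial]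
    rfl
  rw [h, Matrix.mul_apply]
  refine Finset.sum_congr rfl fun l _ => ?_
  rw [Matrix.mul_diagonal, Matrix.transpose_apply]

/-- In an eigenbasis the regularization replaces `1/d` by `d/(d² + r)`, which is `0` at `d = 0` and
tends to `1/d` elsewhere. -/
theorem regularized_inv_mul_apply {n : ℕ} {A : Matrix (Fin n) (Fin n) ℝ} (hA : A.IsHermitian)
    {r : ℝ} (hr : 0 < r) (i j : Fin n) :
    ((A * A + r • 1)⁻¹ * A) i j = ∑ l, eigvecs hA i l *
      (hA.eigenvalues l / (hA.eigenvalues l ^ 2 + r)) * eigvecs hA j l := by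
  set U := eigvecs hA with hU
  set d := hA.eigenvalues with hd
  have hAU : A = U * Matrix.diagonal d * Uᵀ := eq_eigvecs_mul_diagonal hA
  have hUU : U * Uᵀ = 1 := eigvecs_mul_transpose hA
  have hUU' : Uᵀ * U = 1 := eigvecs_transpose_mul hA
  have hconj : ∀ f g : Fin n → ℝ, (U * Matrix.diagonal f * Uᵀ) * (U * Matrix.diagonal g * Uᵀ)
      = U * Matrix.diagonal (fun l => f l * g l) * Uᵀ := by
    intro f g
    calc _ = U * Matrix.diagonal f * (Uᵀ * U) * Matrix.diagonal g * Uᵀ := by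
          simp only [Matrix.mul_assoc]
      _ = _ := by
          rw [hUU', Matrix.mul_one, Matrix.mul_assoc U, Matrix.diagonal_mul_diagonal]
  have hreg : A * A + r • 1 = U * Matrix.diagonal (fun l => d l ^ 2 + r) * Uᵀ := by
    have h1 : (r • 1 : Matrix (Fin n) (Fin n) ℝ) = U * Matrix.diagonal (fun _ => r) * Uᵀ := by
      rw [← Matrix.smul_one_eq_diagonal, Matrix.mul_smul, Matrix.smul_mul, Matrix.mul_one, hUU]
    have h2 : A * A = U * Matrix.diagonal (fun l => d l ^ 2) * Uᵀ := by
      simp only [pow_two]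
      rw [← hconj, ← hAU]
    rw [h1, h2, ← Matrix.add_mul, ← Matrix.mul_add, Matrix.diagonal_add]
  have hne : ∀ l, d l ^ 2 + r ≠ 0 := fun l => by positivity
  have hinv : (A * A + r • 1)⁻¹ = U * Matrix.diagonal (fun l => (d l ^ 2 + r)⁻¹) * Uᵀ := by
    refine Matrix.inv_eq_right_inv ?_
    rw [hreg, hconj]
    simp only [mul_inv_cancel₀ (hne _)]
    rw [Matrix.diagonal_one, Matrix.mul_one, hUU]
  have hprod : (A * A + r • 1)⁻¹ * A
      = U * Matrix.diagonal (fun l => (d l ^ 2 + r)⁻¹ * d l) * Uᵀ := by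
    rw [hinv, ← hconj, ← hAU]
  rw [hprod, Matrix.mul_apply]
  refine Finset.sum_congr rfl fun l _ => ?_
  rw [Matrix.mul_diagonal, Matrix.transpose_apply]
  ring

/-- The Moore–Penrose inverse is a limit of Tikhonov regularizations. -/
theorem tendsto_regularized_symPinv {n : ℕ} {A : Matrix (Fin n) (Fin n) ℝ} (hA : A.IsHermitian)
    (i j : Fin n) :
    Tendsto (fun k : ℕ => ((A * A + (1 / ((k : ℝ) + 1)) • 1)⁻¹ * A) i j) atTop
      (𝓝 (symPinv A i j)) := by
  have hpos : ∀ k : ℕ, (0 : ℝ) < 1 / ((k : ℝ) + 1) := fun k => by positivity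
  simp_rw [regularized_inv_mul_apply hA (hpos _)]
  rw [symPinv_apply hA]
  refine tendsto_finsetSum _ fun l _ => (Tendsto.const_mul _ ?_).mul_const _
  rcases eq_or_ne (hA.eigenvalues l) 0 with h | h
  · simp [h]
  · have h1 : Tendsto (fun k : ℕ => hA.eigenvalues l / (hA.eigenvalues l ^ 2 + 1 / ((k : ℝ) + 1)))
        atTop (𝓝 (hA.eigenvalues l / (hA.eigenvalues l ^ 2 + 0))) :=
      (tendsto_const_nhds).div (tendsto_const_nhds.add tendsto_one_div_add_atTop_nhds_zero_nat)
        (by simpa using h)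
    convert h1 using 2
    field_simp
    simp

variable {α : Type*} [MeasurableSpace α]

theorem measurable_det {m : ℕ} {A : α → Matrix (Fin m) (Fin m) ℝ}
    (hA : ∀ i j, Measurable fun p => A p i j) : Measurable fun p => (A p).det := by
  simp only [Matrix.det_apply']
  exact Finset.measurable_fun_sum _ fun σ _ =>
    measurable_const.mul (Finset.measurable_fun_prod _ fun i _ => hA _ _)

theorem measurable_mul_apply {a b c : Type*} [Fintype b] {A : α → Matrix a b ℝ}
    {B : α → Matrix b c ℝ} (hA : ∀ i j, Measurable fun p => A p i j)
    (hB : ∀ i j, Measurable fun p => B p i j) (i : a) (j : c) :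
    Measurable fun p => (A p * B p) i j := by
  simp only [Matrix.mul_apply]
  exact Finset.measurable_fun_sum _ fun l _ => (hA _ _).mul (hB _ _)

theorem measurable_inv_apply {m : ℕ} {A : α → Matrix (Fin m) (Fin m) ℝ}
    (hA : ∀ i j, Measurable fun p => A p i j) (i j : Fin m) :
    Measurable fun p => (A p)⁻¹ i j := by
  simp only [Matrix.inv_def, Ring.inverse_eq_inv', Matrix.smul_apply, smul_eq_mul,
    Matrix.adjugate_apply]
  refine (measurable_det hA).inv.mul (measurable_det fun k l => ?_)
  by_cases hk : k = j
  · subst hk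
    simp
  · simpa [Matrix.updateRow_ne hk] using hA k l

/-- The chosen eigenvectors need not depend measurably on the matrix. The Tikhonov regularizations
are built from determinants and quotients of the entries, and pointwise limits preserve
measurability. -/
theorem measurable_symPinv_apply {m : ℕ} {A : α → Matrix (Fin m) (Fin m) ℝ}
    (hA : ∀ i j, Measurable fun p => A p i j) (hherm : ∀ p, (A p).IsHermitian) (i j : Fin m) :
    Measurable fun p => symPinv (A p) i j := by
  refine measurable_of_tendsto_metrizable
    (f := fun (k : ℕ) p => ((A p * A p + (1 / ((k : ℝ) + 1)) • 1)⁻¹ * A p) i j) (fun k => ?_)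
    (tendsto_pi_nhds.2 fun p => tendsto_regularized_symPinv (hherm p) i j)
  refine measurable_mul_apply (measurable_inv_apply fun a b => ?_) hA i j
  simp only [Matrix.add_apply]
  exact (measurable_mul_apply hA hA a b).add_const _

theorem measurable_hatMatrix_apply {n s : ℕ} {K : α → Matrix (Fin n) (Fin n) ℝ}
    {S : α → Matrix (Fin s) (Fin n) ℝ} (hK : ∀ i j, Measurable fun p => K p i j)
    (hS : ∀ i j, Measurable fun p => S p i j) (hpsd : ∀ p, (K p).PosSemidef) (lam : ℝ)
    (i j : Fin n) : Measurable fun p => hatMatrix (K p) (S p) lam i j := by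
  have hSt : ∀ i j, Measurable fun p => (S p)ᵀ i j := fun i j => hS j i
  have hK2 : ∀ i j, Measurable fun p => (K p ^ 2) i j := fun i j => by
    simp only [pow_two]
    exact measurable_mul_apply hK hK i j
  have hN : ∀ i j, Measurable fun p => normalMatrix (K p) (S p) lam i j := fun i j => by
    simp only [normalMatrix, Matrix.add_apply, Matrix.smul_apply, smul_eq_mul]
    exact (measurable_mul_apply (measurable_mul_apply hS hK2) hSt i j).add
      ((measurable_mul_apply (measurable_mul_apply hS hK) hSt i j).const_mul _)
  have hP := measurable_symPinv_apply hN fun p => normalMatrix_isHermitian (hpsd p)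
  exact measurable_mul_apply (measurable_mul_apply (measurable_mul_apply
    (measurable_mul_apply hK hSt) hP) hS) hK i j

variable {𝒳 : Type*} [MeasurableSpace 𝒳] {H : Type*} [NormedAddCommGroup H]
  [InnerProductSpace ℝ H] [CompleteSpace H] [RKHS ℝ H 𝒳 ℝ] {PX : Measure 𝒳} {μ : ℕ → ℝ}
  {φ : ℕ → H}

theorem IsMercerExpansion.measurable_kern (h : IsMercerExpansion H PX μ φ) :
    Measurable fun p : 𝒳 × 𝒳 => kern H p.1 p.2 := by
  have hlim : ∀ p : 𝒳 × 𝒳, Tendsto (fun k : ℕ => ∑ i ∈ Finset.range k, μ i * φ i p.1 * φ i p.2)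
      atTop (𝓝 (kern H p.1 p.2)) := fun p => (h.expansion p.1 p.2).tendsto_sum_nat
  refine measurable_of_tendsto_metrizable
    (f := fun (k : ℕ) (p : 𝒳 × 𝒳) => ∑ i ∈ Finset.range k, μ i * φ i p.1 * φ i p.2) (fun k => ?_)
    (tendsto_pi_nhds.2 hlim)
  refine Finset.measurable_fun_sum _ fun i _ => ?_
  have h1 : Measurable fun p : 𝒳 × 𝒳 => φ i p.1 := (h.measurable i).comp measurable_fst
  have h2 : Measurable fun p : 𝒳 × 𝒳 => φ i p.2 := (h.measurable i).comp measurable_snd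
  exact (h1.const_mul (μ i)).mul h2

theorem IsMercerExpansion.measurable_hatMatrix (h : IsMercerExpansion H PX μ φ) {n s : ℕ}
    (lam : ℝ) (i j : Fin n) :
    Measurable fun p : (Fin n → 𝒳) × (Fin s → Fin n → ℝ) =>
      hatMatrix (kernelMatrix H p.1) (Matrix.of p.2) lam i j := by
  refine measurable_hatMatrix_apply
    (K := fun p : (Fin n → 𝒳) × (Fin s → Fin n → ℝ) => kernelMatrix H p.1)
    (S := fun p => Matrix.of p.2) (fun a b => ?_) (fun a b => ?_)
    (fun p => h.kernelMatrix_posSemidef p.1) lam i j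
  · have h1 : Measurable fun p : (Fin n → 𝒳) × (Fin s → Fin n → ℝ) => (p.1 a, p.1 b) :=
      ((measurable_pi_apply a).comp measurable_fst).prodMk
        ((measurable_pi_apply b).comp measurable_fst)
    have h2 := h.measurable_kern.comp h1
    exact Measurable.const_mul (f := fun p : (Fin n → 𝒳) × (Fin s → Fin n → ℝ) =>
      kern H (p.1 a) (p.1 b)) h2 (n : ℝ)⁻¹
  · exact (measurable_pi_apply b).comp ((measurable_pi_apply a).comp measurable_snd)

theorem measurable_pow_apply {n : ℕ} {D : α → Matrix (Fin n) (Fin n) ℝ}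
    (hD : ∀ i j, Measurable fun p => D p i j) (k : ℕ) (i j : Fin n) :
    Measurable fun p => (D p ^ k) i j := by
  induction k generalizing i j with
  | zero => simp
  | succ k ih =>
    simp only [pow_succ]
    exact measurable_mul_apply ih hD i j

theorem measurable_trace_pow {n : ℕ} {D : α → Matrix (Fin n) (Fin n) ℝ}
    (hD : ∀ i j, Measurable fun p => D p i j) (k : ℕ) :
    Measurable fun p => (D p ^ k).trace :=
  Finset.measurable_fun_sum _ fun i _ => measurable_pow_apply hD k i i

theorem measurable_nullMean {n : ℕ} {D : α → Matrix (Fin n) (Fin n) ℝ}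
    (hD : ∀ i j, Measurable fun p => D p i j) : Measurable fun p => nullMean (D p) :=
  (measurable_trace_pow hD 2).div_const _

theorem measurable_nullVar {n : ℕ} {D : α → Matrix (Fin n) (Fin n) ℝ}
    (hD : ∀ i j, Measurable fun p => D p i j) : Measurable fun p => nullVar (D p) :=
  ((measurable_trace_pow hD 4).const_mul _).div_const _

theorem measurable_quadStat {n : ℕ} {D : α → Matrix (Fin n) (Fin n) ℝ}
    (hD : ∀ i j, Measurable fun p => D p i j) :
    Measurable fun q : α × (Fin n → ℝ) => quadStat (D q.1) q.2 := by
  have h : ∀ i, Measurable fun q : α × (Fin n → ℝ) => (D q.1 *ᵥ q.2) i := fun i => by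
    simp only [Matrix.mulVec, dotProduct]
    refine Finset.measurable_fun_sum _ fun j _ => ?_
    have h1 : Measurable fun q : α × (Fin n → ℝ) => D q.1 i j := (hD i j).comp measurable_fst
    have h2 : Measurable fun q : α × (Fin n → ℝ) => q.2 j :=
      (measurable_pi_apply j).comp measurable_snd
    exact h1.mul h2
  exact (Finset.measurable_fun_sum _ fun i _ => (h i).mul (h i)).const_mul _

end Measurability

/-! ### Conditioning on an independent variable -/

section Freezing

variable {Ω β γ : Type*} [MeasurableSpace Ω] [mβ : MeasurableSpace β] [MeasurableSpace γ]
  {P : Measure Ω} [IsProbabilityMeasure P] {Y : Ω → β} {e : Ω → γ}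

/-- Freezing lemma: conditioning on a variable independent of `e` integrates out `e`. -/
theorem condExp_eq_integral_of_indepFun [StandardBorelSpace γ] [Nonempty γ]
    (hY : Measurable Y) (he : Measurable e) (hind : IndepFun e Y P) {f : β × γ → ℝ}
    (hf : Measurable f) (hint : Integrable (fun ω => f (Y ω, e ω)) P) :
    P[fun ω => f (Y ω, e ω) | mβ.comap Y] =ᵐ[P] fun ω => ∫ z, f (Y ω, z) ∂(P.map e) := by
  have : IsProbabilityMeasure (P.map e) := Measure.isProbabilityMeasure_map he.aemeasurable
  have h1 := condExp_prod_ae_eq_integral_condDistrib hY he.aemeasurable hf.stronglyMeasurable hint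
  -- Independence makes the conditional law of `e` given `Y` constant.
  have h2 : condDistrib e Y P =ᵐ[P.map Y] Kernel.const β (P.map e) := by
    rw [condDistrib_ae_eq_iff_measure_eq_compProd Y he.aemeasurable, Measure.compProd_const]
    exact (indepFun_iff_map_prod_eq_prod_map_map hY.aemeasurable he.aemeasurable).1 hind.symm
  filter_upwards [h1, ae_of_ae_map hY.aemeasurable h2] with ω hω1 hω2
  rw [hω1, hω2, Kernel.const_apply]

end Freezing

/-- From `‖Δw‖² ≤ ⟨w, Δw⟩ ≤ ‖w‖ ‖Δw‖`. It supplies both the integrable domination of the statistic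
and the eigenvalue bound in the limit theorem. -/
theorem hatMatrix_mulVec_dotProduct_self_le {n s : ℕ} {K : Matrix (Fin n) (Fin n) ℝ}
    (hK : K.PosSemidef) {lam : ℝ} (hlam : 0 ≤ lam) (S : Matrix (Fin s) (Fin n) ℝ)
    (w : Fin n → ℝ) :
    (hatMatrix K S lam *ᵥ w) ⬝ᵥ (hatMatrix K S lam *ᵥ w) ≤ w ⬝ᵥ w := by
  have h1 := hatMatrix_contraction (S := S) hK hlam w
  have h2 := dotProduct_sq_le w (hatMatrix K S lam *ᵥ w)
  have h3 := dotProduct_self_nonneg' (hatMatrix K S lam *ᵥ w)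
  have h4 := dotProduct_self_nonneg' w
  rcases h3.eq_or_lt with h0 | h0
  · rwa [← h0]
  · have h5 := pow_le_pow_left₀ h3 h1 2
    exact le_of_mul_le_mul_right (by linarith [pow_two (hatMatrix K S lam *ᵥ w ⬝ᵥ
      hatMatrix K S lam *ᵥ w)]) h0

/-! ### The statistic as a quadratic form in the responses -/

section Estimator

variable {𝒳 : Type*} {H : Type*} [NormedAddCommGroup H] [InnerProductSpace ℝ H]
  [RKHS ℝ H 𝒳 ℝ]

theorem response_zero {n : ℕ} (x : Fin n → 𝒳) (ε : Fin n → ℝ) :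
    response (0 : H) x ε = ε := by
  funext i
  have h : (0 : H) (x i) = 0 := congrFun (RKHS.coe_zero (𝕜 := ℝ) (H := H)) (x i)
  simp [response, h]

variable [CompleteSpace H]

/-- The squared empirical norm of the sketched estimator is `n⁻¹ ‖Δ y‖²`. -/
theorem IsSketchedKRR.empNormSq_eq {n s : ℕ} {x : Fin n → 𝒳} {y : Fin n → ℝ}
    {S : Matrix (Fin s) (Fin n) ℝ} {lam : ℝ} {g : H} (h : IsSketchedKRR x y S lam g)
    (hK : (kernelMatrix H x).PosSemidef) (hlam : 0 ≤ lam) :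
    empNormSq x g = quadStat (hatMatrix (kernelMatrix H x) S lam) y := by
  obtain ⟨β, hβ, hg⟩ := h
  rw [empNormSq, quadStat, ← fitted_eq_of_isMinimizer hK hlam y hβ]
  congr 1
  refine Finset.sum_congr rfl fun i _ => ?_
  have hn : (n : ℝ) ≠ 0 := by
    have := i.pos
    positivity
  have : g (x i) = ((n : ℝ) • (kernelMatrix H x *ᵥ (Sᵀ *ᵥ β))) i := by
    rw [hg, Pi.smul_apply, smul_eq_mul, Matrix.mulVec, dotProduct, Finset.mul_sum]
    refine Finset.sum_congr rfl fun j _ => ?_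
    simp only [kernelMatrix, Matrix.of_apply]
    field_simp
  rw [this, pow_two]

end Estimator

/-! ### Conditional moments and the unconditional characteristic function -/

section Conditional

variable {Ω β : Type*} [MeasurableSpace Ω] [mβ : MeasurableSpace β] {P : Measure Ω}
  {n : ℕ} {Y : Ω → β} {e : Ω → Fin n → ℝ}
  {D : β → Matrix (Fin n) (Fin n) ℝ}

theorem map_eq_stdNormalPi [IsProbabilityMeasure P] (he : Measurable e)
    (hlaw : ∀ i, P.map (fun ω => e ω i) = gaussianReal 0 1)
    (hind : iIndepFun (fun i ω => e ω i) P) : P.map e = stdNormalPi n := by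
  have h := (iIndepFun_iff_map_fun_eq_pi_map
    fun i => ((measurable_pi_apply i).comp he).aemeasurable).1 hind
  have h2 : ∀ i, P.map ((fun f : Fin n → ℝ => f i) ∘ e) = gaussianReal 0 1 := hlaw
  simp only [h2] at h
  exact h

/-- Contraction dominates the statistic by `n⁻¹‖e‖²`, whose second moment is finite. -/
theorem memLp_quadStat (hY : Measurable Y) (he : Measurable e) (hlaw : P.map e = stdNormalPi n)
    (hD : ∀ i j, Measurable fun p => D p i j)
    (hle : ∀ p w, (D p *ᵥ w) ⬝ᵥ (D p *ᵥ w) ≤ w ⬝ᵥ w) :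
    MemLp (fun ω => quadStat (D (Y ω)) (e ω)) 2 P := by
  have h1 : MemLp (fun z : Fin n → ℝ => (n : ℝ)⁻¹ * ∑ j, z j ^ 2) 2 (P.map e) := by
    rw [hlaw]
    exact (memLp_finsetSum _ fun j _ => memLp_eval_sq j).const_mul _
  have h2 := h1.comp_of_map he.aemeasurable
  refine h2.mono ((measurable_quadStat hD).comp (hY.prodMk he)).aestronglyMeasurable
    (ae_of_all _ fun ω => ?_)
  have h3 := hle (Y ω) (e ω)
  have h4 := dotProduct_self_nonneg' (D (Y ω) *ᵥ e ω)
  have h5 : ∑ j, e ω j ^ 2 = e ω ⬝ᵥ e ω := by simp [dotProduct, pow_two]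
  rw [Function.comp_apply, h5, quadStat, Real.norm_of_nonneg (by positivity),
    Real.norm_of_nonneg (mul_nonneg (by positivity) (h4.trans h3))]
  gcongr

variable [IsProbabilityMeasure P]

theorem condExp_quadStat (hY : Measurable Y) (he : Measurable e)
    (hlaw : P.map e = stdNormalPi n) (hind : IndepFun e Y P)
    (hD : ∀ i j, Measurable fun p => D p i j) (hherm : ∀ p, (D p).IsHermitian)
    (hle : ∀ p w, (D p *ᵥ w) ⬝ᵥ (D p *ᵥ w) ≤ w ⬝ᵥ w) :
    P[fun ω => quadStat (D (Y ω)) (e ω) | mβ.comap Y] =ᵐ[P] fun ω => nullMean (D (Y ω)) := by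
  have h := condExp_eq_integral_of_indepFun hY he hind (measurable_quadStat hD)
    ((memLp_quadStat hY he hlaw hD hle).integrable (by norm_num))
  simpa only [hlaw, integral_quadStat (hherm _)] using h

theorem condVar_quadStat (hY : Measurable Y) (he : Measurable e)
    (hlaw : P.map e = stdNormalPi n) (hind : IndepFun e Y P)
    (hD : ∀ i j, Measurable fun p => D p i j) (hherm : ∀ p, (D p).IsHermitian)
    (hle : ∀ p w, (D p *ᵥ w) ⬝ᵥ (D p *ᵥ w) ≤ w ⬝ᵥ w) :
    Var[fun ω => quadStat (D (Y ω)) (e ω); P | mβ.comap Y]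
      =ᵐ[P] fun ω => nullVar (D (Y ω)) := by
  have hL := memLp_quadStat hY he hlaw hD hle
  have hmean := condExp_quadStat hY he hlaw hind hD hherm hle
  -- The conditional mean is replaced by an explicit function of `Y`, so that the freezing lemma
  -- applies to the squared deviation.
  have hsq : (((fun ω => quadStat (D (Y ω)) (e ω))
      - P[fun ω => quadStat (D (Y ω)) (e ω) | mβ.comap Y]) ^ 2)
      =ᵐ[P] fun ω => (quadStat (D (Y ω)) (e ω) - nullMean (D (Y ω))) ^ 2 := by
    filter_upwards [hmean] with ω hω
    simp only [Pi.pow_apply, Pi.sub_apply, hω]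
  have hint : Integrable (fun ω => (quadStat (D (Y ω)) (e ω) - nullMean (D (Y ω))) ^ 2) P :=
    (hL.sub (hL.condExp (by norm_num))).integrable_sq.congr hsq
  have hm : Measurable fun q : β × (Fin n → ℝ) => (quadStat (D q.1) q.2 - nullMean (D q.1)) ^ 2 :=
    ((measurable_quadStat hD).sub ((measurable_nullMean hD).comp measurable_fst)).pow_const 2
  have h := condExp_eq_integral_of_indepFun hY he hind hm hint
  refine (condExp_congr_ae hsq).trans ?_
  simpa only [hlaw, integral_quadStat_sub_sq (hherm _)] using h

theorem measurable_standardized (hY : Measurable Y) (he : Measurable e)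
    (hD : ∀ i j, Measurable fun p => D p i j) :
    Measurable fun ω =>
      (quadStat (D (Y ω)) (e ω) - nullMean (D (Y ω))) / √(nullVar (D (Y ω))) :=
  (((measurable_quadStat hD).comp (hY.prodMk he)).sub ((measurable_nullMean hD).comp hY)).div
    ((measurable_nullVar hD).comp hY).sqrt

/-- The characteristic function of a randomized quadratic statistic is controlled by its
conditional characteristic function off an exceptional event. -/
theorem norm_charFun_standardized_sub_le (hY : Measurable Y) (he : Measurable e)
    (hlaw : P.map e = stdNormalPi n) (hind : IndepFun e Y P)
    (hD : ∀ i j, Measurable fun p => D p i j) {t η : ℝ} (hη : 0 ≤ η) {B : Set β}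
    (hB : MeasurableSet B)
    (hbound : ∀ p ∉ B,
      ‖∫ z, Complex.exp (t * ((quadStat (D p) z - nullMean (D p)) / √(nullVar (D p)) : ℝ)
        * Complex.I) ∂(stdNormalPi n) - Complex.exp (-(t : ℂ) ^ 2 / 2)‖ ≤ η) :
    ‖charFun (P.map fun ω =>
        (quadStat (D (Y ω)) (e ω) - nullMean (D (Y ω))) / √(nullVar (D (Y ω)))) t
      - Complex.exp (-(t : ℂ) ^ 2 / 2)‖ ≤ η + 2 * P.real (Y ⁻¹' B) := by
  have hPY : IsProbabilityMeasure (P.map Y) := Measure.isProbabilityMeasure_map hY.aemeasurable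
  set G := Complex.exp (-(t : ℂ) ^ 2 / 2) with hG
  have hG1 : ‖G‖ ≤ 1 := by
    rw [hG, Complex.norm_exp,
      show (-(t : ℂ) ^ 2 / 2) = ((-t ^ 2 / 2 : ℝ) : ℂ) by push_cast; ring, Complex.ofReal_re]
    exact Real.exp_le_one_iff.2 (by nlinarith [sq_nonneg t])
  set Z : β × (Fin n → ℝ) → ℝ := fun q =>
    (quadStat (D q.1) q.2 - nullMean (D q.1)) / √(nullVar (D q.1)) with hZ
  have hZm : Measurable Z := measurable_standardized measurable_fst measurable_snd hD
  have hEm : Measurable fun q => Complex.exp (t * (Z q : ℝ) * Complex.I) := by fun_prop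
  have hnorm : ∀ q, ‖Complex.exp (t * (Z q : ℝ) * Complex.I)‖ = 1 := fun q => by
    rw [← Complex.ofReal_mul, Complex.norm_exp_ofReal_mul_I]
  have hint : Integrable (fun q => Complex.exp (t * (Z q : ℝ) * Complex.I))
      ((P.map Y).prod (stdNormalPi n)) :=
    Integrable.of_bound hEm.aestronglyMeasurable 1 (ae_of_all _ fun q => (hnorm q).le)
  have hjoint : P.map (fun ω => (Y ω, e ω)) = (P.map Y).prod (stdNormalPi n) := by
    rw [← hlaw]
    exact (indepFun_iff_map_prod_eq_prod_map_map hY.aemeasurable he.aemeasurable).1 hind.symm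
  have hchar : charFun (P.map fun ω => Z (Y ω, e ω)) t
      = ∫ p, ∫ z, Complex.exp (t * (Z (p, z) : ℝ) * Complex.I) ∂(stdNormalPi n) ∂(P.map Y) := by
    rw [← integral_prod _ hint, ← hjoint, integral_map (hY.prodMk he).aemeasurable
      hEm.aestronglyMeasurable, charFun_apply_real]
    exact integral_map (hZm.comp (hY.prodMk he)).aemeasurable
      (Continuous.aestronglyMeasurable (by fun_prop))
  have hsub : charFun (P.map fun ω => Z (Y ω, e ω)) t - G
      = ∫ p, ((∫ z, Complex.exp (t * (Z (p, z) : ℝ) * Complex.I) ∂(stdNormalPi n)) - G)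
        ∂(P.map Y) := by
    rw [integral_sub hint.integral_prod_left (integrable_const _), hchar]
    simp
  change ‖charFun (P.map fun ω => Z (Y ω, e ω)) t - G‖ ≤ _
  rw [hsub]
  -- On `B` the difference of two numbers in the unit disc is at most `2`.
  have hle : ∀ p, ‖(∫ z, Complex.exp (t * (Z (p, z) : ℝ) * Complex.I) ∂(stdNormalPi n)) - G‖
      ≤ η + B.indicator (fun _ => (2 : ℝ)) p := by
    intro p
    by_cases hp : p ∈ B
    · rw [Set.indicator_of_mem hp]
      have h1 : ‖∫ z, Complex.exp (t * (Z (p, z) : ℝ) * Complex.I) ∂(stdNormalPi n)‖ ≤ 1 := by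
        refine (norm_integral_le_integral_norm _).trans ?_
        simp [hnorm]
      exact (norm_sub_le _ _).trans (by linarith)
    · rw [Set.indicator_of_notMem hp, add_zero]
      exact hbound p hp
  refine (norm_integral_le_of_norm_le ((integrable_const η).add
    ((integrable_const (2 : ℝ)).indicator hB)) (ae_of_all _ hle)).trans (le_of_eq ?_)
  simp only [Pi.add_apply]
  rw [integral_add (integrable_const η) ((integrable_const (2 : ℝ)).indicator hB),
    integral_indicator_const _ hB, map_measureReal_apply hY hB]
  simp [mul_comm]

end Conditional

end SketchedKRR

/-! ### Assembly of the theorem -/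

theorem theorem4p2
    -- the reproducing kernel Hilbert space, the design distribution and the kernel spectrum
    {𝒳 : Type*} [MeasurableSpace 𝒳] {H : Type*} [NormedAddCommGroup H] [InnerProductSpace ℝ H]
    [CompleteSpace H] [RKHS ℝ H 𝒳 ℝ]
    (PX : Measure 𝒳) [IsProbabilityMeasure PX] (μ : ℕ → ℝ) (φ : ℕ → H)
    (hMercer : SketchedKRR.IsMercerExpansion H PX μ φ)
    (hRegular : SketchedKRR.EigenRegular H μ φ)
    -- smoothing parameter and sketch dimension
    (lam : ℕ → ℝ) (s : ℕ → ℕ) (hlam_pos : ∀ n, 0 < lam n)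
    (hlam : Tendsto lam atTop (𝓝 0)) (hs : Tendsto s atTop atTop)
    -- for each sample size: the design, the noise and the random sketching matrix
    {Ω : ℕ → Type*} [∀ n, MeasurableSpace (Ω n)] (P : ∀ n, Measure (Ω n))
    [∀ n, IsProbabilityMeasure (P n)]
    (x : ∀ n, Ω n → Fin n → 𝒳) (ε : ∀ n, Ω n → Fin n → ℝ)
    (S : ∀ n, Ω n → Fin (s n) → Fin n → ℝ)
    (hx : ∀ n, Measurable (x n)) (hε : ∀ n, Measurable (ε n)) (hS : ∀ n, Measurable (S n))
    (hx_law : ∀ n i, (P n).map (fun ω => x n ω i) = PX)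
    (hx_indep : ∀ n, iIndepFun (fun i ω => x n ω i) (P n))
    (hε_law : ∀ n i, (P n).map (fun ω => ε n ω i) = gaussianReal 0 1)
    (hε_indep : ∀ n, iIndepFun (fun i ω => ε n ω i) (P n))
    (hε_xS : ∀ n, IndepFun (ε n) (fun ω => (x n ω, S n ω)) (P n))
    -- the sketch is satisfiable for the kernel matrix with high conditional probability
    (hSat : ∃ c : ℝ, 0 < c ∧ ∃ c₁ c₂ : ℝ≥0∞, 0 < c₁ ∧ 0 < c₂ ∧ ∀ᶠ n in atTop,
      SketchedKRR.IsOfType (P n) (x n)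
        {ω | SketchedKRR.KSatisfiable (SketchedKRR.kernelMatrix_isHermitian H (x n ω))
          (lam n) c (Matrix.of (S n ω))}
        (c₁ * s n) (c₂ * SketchedKRR.effDim μ (lam n)))
    -- the null hypothesis on the regression function, and the estimator
    (f : H) (hH₀ : f = 0) (fhat : ∀ n, Ω n → H)
    (hfhat : ∀ n ω, SketchedKRR.IsSketchedKRR (x n ω)
      (SketchedKRR.response f (x n ω) (ε n ω)) (Matrix.of (S n ω)) (lam n) (fhat n ω))
    (T : ∀ n, Ω n → ℝ) (hT : ∀ n ω, T n ω = SketchedKRR.empNormSq (x n ω) (fhat n ω))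
    (Δ : ∀ n, Ω n → Matrix (Fin n) (Fin n) ℝ)
    (hΔ : ∀ n ω, Δ n ω = SketchedKRR.hatMatrix (SketchedKRR.kernelMatrix H (x n ω))
      (Matrix.of (S n ω)) (lam n)) :
    (∀ n, MemLp (T n) 2 (P n)) ∧
    (∀ n, (P n)[T n | MeasurableSpace.comap (fun ω => (x n ω, S n ω)) inferInstance]
      =ᵐ[P n] fun ω => SketchedKRR.nullMean (Δ n ω)) ∧
    (∀ n, Var[T n; P n | MeasurableSpace.comap (fun ω => (x n ω, S n ω)) inferInstance]
      =ᵐ[P n] fun ω => SketchedKRR.nullVar (Δ n ω)) ∧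
    TendstoInDistribution
      (fun n ω => (T n ω - SketchedKRR.nullMean (Δ n ω)) / √(SketchedKRR.nullVar (Δ n ω)))
      atTop (id : ℝ → ℝ) P (gaussianReal 0 1) := by
  open SketchedKRR in
  set Y : ∀ n, Ω n → (Fin n → 𝒳) × (Fin (s n) → Fin n → ℝ) := fun n ω => (x n ω, S n ω) with hYdef
  set D : ∀ n, (Fin n → 𝒳) × (Fin (s n) → Fin n → ℝ) → Matrix (Fin n) (Fin n) ℝ := fun n p =>
    hatMatrix (kernelMatrix H p.1) (Matrix.of p.2) (lam n) with hDdef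
  have hY : ∀ n, Measurable (Y n) := fun n => (hx n).prodMk (hS n)
  have hlaw : ∀ n, (P n).map (ε n) = stdNormalPi n := fun n =>
    map_eq_stdNormalPi (hε n) (hε_law n) (hε_indep n)
  have hpsd : ∀ n (p : Fin n → 𝒳), (kernelMatrix H p).PosSemidef := fun n p =>
    hMercer.kernelMatrix_posSemidef p
  have hDm : ∀ n i j, Measurable fun p => D n p i j := fun n i j =>
    hMercer.measurable_hatMatrix (lam n) i j
  have hDh : ∀ n p, (D n p).IsHermitian := fun n p => hatMatrix_isHermitian (hpsd n p.1)
  have hDle : ∀ n p w, (D n p *ᵥ w) ⬝ᵥ (D n p *ᵥ w) ≤ w ⬝ᵥ w := fun n p w =>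
    hatMatrix_mulVec_dotProduct_self_le (hpsd n p.1) (hlam_pos n).le _ w
  have hΔ' : Δ = fun n ω => D n (Y n ω) := by
    funext n ω
    exact hΔ n ω
  have hT' : T = fun n ω => quadStat (D n (Y n ω)) (ε n ω) := by
    funext n ω
    rw [hT, (hfhat n ω).empNormSq_eq (hpsd n _) (hlam_pos n).le, hH₀, response_zero]
  subst hΔ' hT'
  refine ⟨fun n => memLp_quadStat (hY n) (hε n) (hlaw n) (hDm n) (hDle n),
    fun n => condExp_quadStat (hY n) (hε n) (hlaw n) (hε_xS n) (hDm n) (hDh n) (hDle n),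
    fun n => condVar_quadStat (hY n) (hε n) (hlaw n) (hε_xS n) (hDm n) (hDh n) (hDle n), ?_⟩
  refine ⟨fun n => (measurable_standardized (hY n) (hε n) (hDm n)).aemeasurable,
    aemeasurable_id, ?_⟩
  -- Lévy's continuity theorem. The error `η` is shared as `η/2` from the conditional limit theorem
  -- and `2 * (η/4)` from the event of small trace.
  refine ProbabilityMeasure.tendsto_iff_tendsto_charFun.2 fun t => ?_
  have hlimit : charFun ((gaussianReal 0 1).map (id : ℝ → ℝ)) t
      = Complex.exp (-(t : ℂ) ^ 2 / 2) := by
    rw [Measure.map_id, charFun_gaussianReal]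
    congr 1
    simp
    ring
  obtain ⟨c, -, c₁, c₂, hc₁, hc₂, hSat⟩ := hSat
  simp only [ProbabilityMeasure.coe_mk]
  rw [hlimit, Metric.tendsto_atTop']
  intro η hη
  obtain ⟨R, hR⟩ := exists_norm_charFun_quadStat_sub_le t (half_pos hη)
  have htr := tendsto_measure_trace_hatMatrix_lt PX μ φ hMercer hRegular lam s hlam_pos hlam hs P x S
    hx hx_law hx_indep hc₁ hc₂ hSat R
  have htr' : Tendsto (fun n => (P n).real (Y n ⁻¹' {p | (D n p ^ 4).trace < R})) atTop (𝓝 0) := by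
    exact (ENNReal.tendsto_toReal ENNReal.zero_ne_top).comp htr
  obtain ⟨N, hN⟩ := eventually_atTop.1
    (htr'.eventually (gt_mem_nhds (show (0 : ℝ) < η / 4 by positivity)))
  refine ⟨N, fun n hn => ?_⟩
  have hmeas : MeasurableSet {p | (D n p ^ 4).trace < R} :=
    measurableSet_lt (measurable_trace_pow (hDm n) 4) measurable_const
  have hb := norm_charFun_standardized_sub_le (hY n) (hε n) (hlaw n) (hε_xS n) (hDm n)
    (half_pos hη).le hmeas (t := t) fun p hp => hR n (D n p) (hDh n p) (fun j => by
      -- Testing the contraction at the `j`-th eigenvector bounds the squared eigenvalue by `1`.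
      have h1 := hDle n p (eigvec (hDh n p) j)
      rw [mulVec_dotProduct_self_eq_sum (hDh n p), eigvecs_transpose_mulVec_eigvec,
        eigvec_dotProduct_self, Finset.sum_eq_single j (fun i _ hi => by simp [hi])
          (by simp)] at h1
      simpa using h1) (not_lt.1 hp)
  rw [dist_eq_norm]
  refine lt_of_le_of_lt hb ?_
  have := hN n hn.le
  linarith
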